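/- Let $L$ be a nearly plat front projection of a Legendrian knot (or link) in standard contact $\mathbb R^3$: it is obtained by slightly perturbing a front with all left cusps on one vertical line, all right cusps on one vertical line and all crossings at distinct $x$-coordinates, so that the cusps have distinct $x$-coordinates as well. Fronts are considered up to planar isotopy. Let $\mu$ be a $\mathbb Z$-valued Maslov potential on $L$, let $Q(L)$ be the set of crossings and right cusps of $L$, graded by $|a|=1$ for a right cusp and $|a|=\mu(T)-\mu(B)$ for a crossing of the strands $T,B$ where $T$ has the smaller slope, and let $\mathcal A(L)$ be the unital tensor algebra of the $\mathbb Z_2$-vector space with basis $Q(L)$. Strands over a vertical line are numbered from top to bottom. *The Chekanov–Eliashberg differential.* For a word $w$ in $Q(L)$ let $\Delta(a,w)$ be the set of admissible disks (up to diffeomorphism) originating at $a$, i.e. immersed disks with boundary on $L$ whose right-most point is $a$ (the disk filling the left quadrant of the crossing $a$ or the inside of the right cusp $a$), whose left-most point is a left cusp with its inside filled, whose other corners are convex corners filling the upper or lower quadrant of a crossing, and whose convex corners, read counter-clockwise from $a$, form $w$. Then $\partial a=\delta_a+\sum_w\#\Delta(a,w)\,w$ with counts mod $2$, where $\delta_a=1$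 if $a$ is a right cusp and $\delta_a=0$ otherwise, and $\partial$ is extended by linearity and the Leibniz rule. An augmentation is a unital algebra map $\epsilon:\mathcal A(L)\to\mathbb Z_2$ with $\epsilon\circ\partial=0$ and with $|q|=0$ for every generator $q$ with $\epsilon(q)=1$. It gives the automorphism $\phi^\epsilon(q)=q+\epsilon(q)$ and the differential $\partial^\epsilon=\phi^\epsilon\,\partial\,(\phi^\epsilon)^{-1}$. *Morse complex sequences.* An MCS $\mathcal C$ for $(L,\mu)$ consists of handleslide marks on $L$ (vertical segments, away from crossings and cusps, joining two strands of equal Maslov potential), vertical lines $x=x_1<\dots<x_M$ that meet $L$ and cut it into tangles each containing exactly one crossing, cusp or handleslide mark, and for each $m$ a complex $(C_m,d_m)$ over $\mathbb Z_2$ whose basis $e_1,e_2,\dots$ is the set of strands at $x_m$, graded by $\mu$, with $d_m$ of degree $-1$ and $d_me_i\in\mathrm{span}\{e_j:j>i\}$ (to the left and to the right of $L$ the complex is $0$). The complexes at the left and right border of a tangle, $(C,d)$ and $(C',d')$, are related as follows. *Crossing of strands $k,k+1$:* $\langle de_k,e_{k+1}\rangle=0$ and the transposition of $e_k,e_{k+1}$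 is an isomorphism of complexes $C\to C'$. *Left cusp with strands $k,k+1$ on its right:* $\langle d'e_k,e_{k+1}\rangle=1$, and $e_i\mapsto[e_i]$ for $i<k$, $e_i\mapsto[e_{i+2}]$ for $i\ge k$, is an isomorphism of complexes from $C$ to the quotient of $C'$ by the span of $e_k,d'e_k$. *Right cusp:* the same with $C$ and $C'$ exchanged. *Handleslide mark between strands $k<l$:* $e_k\mapsto e_k+e_l$, $e_i\mapsto e_i$ $(i\ne k)$ is an isomorphism of complexes $C\to C'$. *The MCS-DGA.* A chord $(x_m,[i,j])$, $i<j$, is a vertical segment at $x_m$ from strand $i$ down to strand $j$. A chord path with convex corners from $a\in Q(L)$ to a crossing $b$ is a finite sequence of chords on successive lines $x_m$ from right to left such that: the first chord is $[k,k+1]$ on the line just to the left of $a$, where $k,k+1$ are the strands meeting at $a$; the last chord is on the line $x_{p+1}$ just to the right of $b$ and, if strands $k,k+1$ cross at $b$, it is $[i,k]$ with $\langle d_pe_i,e_k\rangle=1$ or $[k+1,j]$ with $\langle d_pe_{k+1},e_j\rangle=1$; and the steps in between, from $[i,j]$ to the next chord on its left, are as follows. At a crossing of strands $k,k+1$: either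 the endpoints stay on their strands (not allowed for $[k,k+1]$), or $[i,k]\to[i,k]$ (a convex corner at the bottom), or $[k+1,j]\to[k+1,j]$ (a convex corner at the top). At a right cusp: the endpoints stay on their strands. At a handleslide mark between strands $k<l$: $[i,j]\to[i,j]$, or $[k,j]\to[l,j]$ if $l<j$, or $[i,l]\to[i,k]$ if $i<k$. The word of such a path consists of its top convex corners from right to left, then $b$, then its bottom convex corners from left to right. Let $\mathcal M^{\mathcal C}(a;b_1,\dots,b_n)$ be the set of these paths from $a$ with word $b_1\cdots b_n$. The MCS-DGA $(\mathcal A_{\mathcal C},d)$ is the tensor algebra on $Q(L)$ with the same grading, and $da=\sum\#\mathcal M^{\mathcal C}(a;b_1,\dots,b_n)\,b_1\cdots b_n$ (counts mod $2$, sum over all words with $n\ge1$ and $|b_1|+\dots+|b_n|=|a|-1$), extended by linearity and the Leibniz rule. *$A$-form.* $\mathcal C$ is in $A$-form if (i) it is simple: at each left cusp whose strands on its right are $k,k+1$, the differential $d'$ on its right satisfies $\langle d'e_i,e_{k+1}\rangle=0$ for $i<k$ and $\langle d'e_k,e_j\rangle=0$ for $j>k+1$; and (ii) each handleslide mark lies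 immediately to the left of a crossing and joins the two strands that cross there, with at most one mark per crossing. A crossing with such a mark is called marked. The algebra map $\epsilon_{\mathcal C}:\mathcal A(L)\to\mathbb Z_2$ corresponding to $\mathcal C$ is given by $\epsilon_{\mathcal C}(q)=1$ if $q$ is a marked crossing and $\epsilon_{\mathcal C}(q)=0$ for all other generators $q$. **Theorem.** If $\mathcal C$ is an $A$-form MCS for $L$, then $\epsilon_{\mathcal C}$ is an augmentation of $(\mathcal A(L),\partial)$, and under the identity map of the set $Q(L)$ of generators, which preserves the grading, $d=\partial^{\epsilon_{\mathcal C}}$. Hence $(\mathcal A_{\mathcal C},d)=(\mathcal A(L),\partial^{\epsilon_{\mathcal C}})$. -/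

import Mathlib

/-!
# Nearly plat fronts, their Chekanov–Eliashberg algebra, Morse complex sequences and chord paths

A generic front projection is recorded, up to isotopy of the plane through generic fronts, by the
list of its crossings and cusps from left to right.  Strands over a vertical line are numbered
`0, 1, 2, …` from top to bottom (so "strands `k` and `k + 1`" are adjacent, `k` being the upper
one).
-/

namespace Legendrian

/-- A crossing or a cusp of a front.  For a crossing the parameter `k` says that the strands `k` and
`k + 1` cross.  For a right (left) cusp, `k` and `k + 1` are the two strands which meet at the cusp,
numbered on the vertical line just to the left (right) of it. -/
inductive Singularity
  | leftCusp (k : ℕ)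
  | crossing (k : ℕ)
  | rightCusp (k : ℕ)

/-- The number of strands to the right of a singularity that has `s` strands to its left. -/
def Singularity.strandsAfter : Singularity → ℕ → ℕ
  | .leftCusp _, s => s + 2
  | .crossing _, s => s
  | .rightCusp _, s => s - 2

/-- The singularity can be placed to the right of a vertical line that meets `s` strands. -/
def Singularity.Fits : Singularity → ℕ → Prop
  | .leftCusp k, s => k ≤ s
  | .crossing k, s => k + 1 < s
  | .rightCusp k, s => k + 1 < s

/-- The number of strands over a vertical line which has exactly the first `g` singularities of the
list `w` to its left. -/
def strandCount (w : List Singularity) (g : ℕ) : ℕ :=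
  (w.take g).foldl (fun s t => t.strandsAfter s) 0

/-- A front diagram of a Legendrian link whose crossings and cusps have distinct `x`-coordinates,
given by its singularities from left to right. -/
structure Front where
  /-- The crossings and cusps, from left to right. -/
  word : List Singularity
  fits : ∀ (g : ℕ) (h : g < word.length), (word[g]).Fits (strandCount word g)
  closed : strandCount word word.length = 0

namespace Front

/-- The number of strands of `L` over a vertical line with exactly the first `g` singularities to
its left.  Such a line is called the line in gap `g`; singularity number `g` lies between the lines
in gap `g` and in gap `g + 1`. -/
def strands (L : Front) (g : ℕ) : ℕ := strandCount L.word g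

/-- `L` is nearly plat: it arises from a plat front (all left cusps on one vertical line, all right
cusps on one vertical line) by a small perturbation which makes the `x`-coordinates of the cusps
distinct.  So the left cusps come first, then the crossings, then the right cusps.  The cusps are
not nested, because before the perturbation the strands next to the cusps are paired as
`{0, 1}, {2, 3}, …`: this says that the upper strand at each cusp has an even number. -/
def IsNearlyPlat (L : Front) : Prop :=
  ∃ l c r : List ℕ, L.word = l.map .leftCusp ++ c.map .crossing ++ r.map .rightCusp ∧
    (∀ k ∈ l, Even k) ∧ (∀ k ∈ r, Even k)

end Front

/-- Renumbering of strands when two strands with numbers `k` and `k + 1` are inserted. -/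
def shift (k i : ℕ) : ℕ := if i < k then i else i + 2

/-- A Maslov potential on the front `L`: `val g i` is the value on strand `i` over the line in
gap `g`.  It is constant along strands, and at each cusp it is larger by `1` on the upper strand.
(Values at pairs `(g, i)` with `L.strands g ≤ i` play no role.) -/
structure Front.MaslovPotential (L : Front) where
  val : ℕ → ℕ → ℤ
  crossing : ∀ g k, L.word[g]? = some (.crossing k) →
    ∀ i < L.strands g, val (g + 1) (Equiv.swap k (k + 1) i) = val g i
  leftCusp : ∀ g k, L.word[g]? = some (.leftCusp k) →
    (∀ i < L.strands g, val (g + 1) (shift k i) = val g i) ∧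
      val (g + 1) k = val (g + 1) (k + 1) + 1
  rightCusp : ∀ g k, L.word[g]? = some (.rightCusp k) →
    (∀ i < L.strands (g + 1), val g (shift k i) = val (g + 1) i) ∧
      val g k = val g (k + 1) + 1

/-! ### The graded algebra -/

namespace Front

/-- The set `Q(L)` of crossings and right cusps. -/
def Generator (L : Front) : Type :=
  {q : Fin L.word.length //
    (∃ k, L.word.get q = .crossing k) ∨ (∃ k, L.word.get q = .rightCusp k)}

/-- The degree of a generator: `1` for a right cusp, and `μ(T) - μ(B)` for a crossing, where `T` is
the strand of smaller slope, that is, the one which is the upper strand to the left of it. -/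
def degree {L : Front} (μ : L.MaslovPotential) (q : L.Generator) : ℤ :=
  match L.word.get q.1 with
  | .crossing k => μ.val q.1 k - μ.val q.1 (k + 1)
  | .rightCusp _ => 1
  | .leftCusp _ => 0

/-- The unital tensor algebra over `ℤ/2` of the vector space with basis `Q(L)`. -/
abbrev Alg (L : Front) : Type := FreeAlgebra (ZMod 2) L.Generator

/-- The product of the generators in a word. -/
noncomputable def monomial {L : Front} (w : List L.Generator) : L.Alg :=
  (w.map (FreeAlgebra.ι (ZMod 2))).prod

/-- The degree of a word. -/
def wordDegree {L : Front} (μ : L.MaslovPotential) (w : List L.Generator) : ℤ :=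
  (w.map (degree μ)).sum

end Front

section Leibniz

variable {Q : Type}

/-- The algebra homomorphism `x ↦ x + D x · ε`, `ε² = 0`, where `D` is the derivation which is `f` on
generators. -/
noncomputable def leibnizHom (f : Q → FreeAlgebra (ZMod 2) Q) :
    FreeAlgebra (ZMod 2) Q →ₐ[ZMod 2]
      TrivSqZeroExt (FreeAlgebra (ZMod 2) Q) (FreeAlgebra (ZMod 2) Q) :=
  FreeAlgebra.lift (ZMod 2)
    (fun q => TrivSqZeroExt.inl (FreeAlgebra.ι (ZMod 2) q) + TrivSqZeroExt.inr (f q))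

theorem leibnizHom_ι (f : Q → FreeAlgebra (ZMod 2) Q) (q : Q) :
    leibnizHom f (FreeAlgebra.ι (ZMod 2) q) =
      TrivSqZeroExt.inl (FreeAlgebra.ι (ZMod 2) q) + TrivSqZeroExt.inr (f q) :=
  FreeAlgebra.lift_ι_apply _ _

/-- The extension of a map on generators to the free algebra over `ℤ/2` by linearity and the Leibniz
rule `D (x * y) = x * D y + D x * y` (there are no signs over `ℤ/2`). -/
noncomputable def leibnizExt (f : Q → FreeAlgebra (ZMod 2) Q) :
    FreeAlgebra (ZMod 2) Q →ₗ[ZMod 2] FreeAlgebra (ZMod 2) Q where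
  toFun x := (leibnizHom f x).snd
  map_add' x y := by simp
  map_smul' c x := by simp

theorem leibnizExt_ι (f : Q → FreeAlgebra (ZMod 2) Q) (q : Q) :
    leibnizExt f (FreeAlgebra.ι (ZMod 2) q) = f q := by
  simp only [leibnizExt, leibnizHom_ι, LinearMap.coe_mk, AddHom.coe_mk, TrivSqZeroExt.snd_add,
    TrivSqZeroExt.snd_inl, TrivSqZeroExt.snd_inr, zero_add]

theorem leibnizHom_fst (f : Q → FreeAlgebra (ZMod 2) Q) (x : FreeAlgebra (ZMod 2) Q) :
    (leibnizHom f x).fst = x := by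
  have h : (TrivSqZeroExt.fstHom (ZMod 2) (FreeAlgebra (ZMod 2) Q)
      (FreeAlgebra (ZMod 2) Q)).comp (leibnizHom f) = AlgHom.id (ZMod 2) _ := by
    ext q
    simp only [Function.comp_apply, AlgHom.comp_apply, leibnizHom_ι, AlgHom.id_apply,
      TrivSqZeroExt.fstHom_apply, TrivSqZeroExt.fst_add, TrivSqZeroExt.fst_inl,
      TrivSqZeroExt.fst_inr, add_zero]
  exact congrArg (fun F => F x) h

theorem leibnizExt_mul (f : Q → FreeAlgebra (ZMod 2) Q) (x y : FreeAlgebra (ZMod 2) Q) :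
    leibnizExt f (x * y) = x * leibnizExt f y + leibnizExt f x * y := by
  simp [leibnizExt, leibnizHom_fst]

end Leibniz

/-! ### Chords, admissible disks and the Chekanov–Eliashberg differential -/

/-- A chord `(x_m, [i, j])`: a vertical segment over the vertical line number `m = pos`, from strand
`i = top` down to strand `j = bot`. -/
structure Chord where
  pos : ℕ
  top : ℕ
  bot : ℕ

/-- There are only finitely many sequences of chords which advance by one vertical line in each step,
if each line meets finitely many strands and only finitely many lines meet a strand. -/
theorem finite_chordSeq (S : ℕ → ℕ) (N : ℕ) (hS : ∀ m, N ≤ m → S m = 0)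
    (R : Chord → Chord → Prop) (hR : ∀ c c', R c c' → c.pos = c'.pos + 1) :
    {Λ : List Chord | (∀ c ∈ Λ, c.top < c.bot ∧ c.bot < S c.pos) ∧ Λ.IsChain R}.Finite := by
  have key : ∀ n, {Λ : List Chord | (∀ c ∈ Λ, c.top < c.bot ∧ c.bot < S c.pos) ∧ Λ.IsChain R ∧
      ∀ c ∈ Λ.head?, c.pos < n}.Finite := by
    intro n
    induction n with
    | zero =>
      refine (Set.finite_singleton ([] : List Chord)).subset ?_
      rintro (_ | ⟨c, Λ⟩) ⟨_, _, h⟩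
      · rfl
      · simp at h
    | succ n ih =>
      have hfin : {c : Chord | c.pos ≤ n ∧ c.top < c.bot ∧ c.bot < S c.pos}.Finite := by
        refine ((Set.finite_Iic n).biUnion (t := fun p => (fun x : ℕ × ℕ => Chord.mk p x.1 x.2) ''
          (Set.Iio (S p) ×ˢ Set.Iio (S p))) fun p _ =>
            ((Set.finite_Iio _).prod (Set.finite_Iio _)).image _).subset ?_
        rintro ⟨p, i, j⟩ ⟨h1, h2, h3⟩
        refine Set.mem_biUnion h1 ⟨(i, j), ⟨?_, h3⟩, rfl⟩
        exact lt_trans h2 h3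
      refine ((Set.finite_singleton ([] : List Chord)).union
        (Set.Finite.image2 List.cons hfin ih)).subset ?_
      rintro (_ | ⟨c, Λ⟩) ⟨h1, h2, h3⟩
      · exact Or.inl rfl
      · refine Or.inr ⟨c, ⟨?_, h1 c (by simp)⟩, Λ, ⟨fun x hx => h1 x (by simp [hx]), h2.tail, ?_⟩, rfl⟩
        · exact Nat.lt_succ_iff.1 (h3 c (by simp))
        · rcases Λ with _ | ⟨c', Λ⟩
          · simp
          · have h4 := hR _ _ (List.isChain_cons_cons.1 h2).1
            have h5 := h3 c (by simp)
            intro x hx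
            simp only [List.head?_cons, Option.mem_def, Option.some.injEq] at hx
            subst hx
            omega
  refine (key N).subset ?_
  rintro Λ ⟨h1, h2⟩
  refine ⟨h1, h2, fun c hc => ?_⟩
  by_contra hn
  have h3 := (h1 c (List.mem_of_mem_head? hc)).2
  rw [hS _ (not_lt.1 hn)] at h3
  omega

/-- The chord `c` on the right of a crossing of the strands `k` and `k + 1`, and the chord `c'` on
its left, have their endpoints on the same strands, and the chords do not shrink to the crossing
point in between. -/
def SmoothAt (k : ℕ) (c c' : Chord) : Prop :=
  ¬ (c.top = k ∧ c.bot = k + 1) ∧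
    c'.top = Equiv.swap k (k + 1) c.top ∧ c'.bot = Equiv.swap k (k + 1) c.bot

/-- Convex corner in the lower quadrant of a crossing of the strands `k` and `k + 1`: `[k + 1, j]`
on the right of the crossing and `[k + 1, j]` on its left. -/
def TopCornerAt (k : ℕ) (c c' : Chord) : Prop :=
  c.top = k + 1 ∧ c'.top = k + 1 ∧ c'.bot = c.bot

/-- Convex corner in the upper quadrant of a crossing of the strands `k` and `k + 1`: `[i, k]`
on the right of the crossing and `[i, k]` on its left. -/
def BotCornerAt (k : ℕ) (c c' : Chord) : Prop :=
  c.bot = k ∧ c'.bot = k ∧ c'.top = c.top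

namespace Front

open Classical in
/-- The convex corner between `c` and `c'` at the top of the chords, as a word of length at most
one.  Here `slab m` is the singularity, if any, between the lines number `m` and `m + 1`. -/
noncomputable def topCorner (L : Front) (slab : ℕ → Option (Fin L.word.length)) (c c' : Chord) :
    List L.Generator :=
  if h : ∃ q : L.Generator, slab c'.pos = some q.1 ∧
      ∃ k, L.word.get q.1 = .crossing k ∧ TopCornerAt k c c' then [h.choose] else []

open Classical in
/-- The convex corner between `c` and `c'` at the bottom of the chords. -/
noncomputable def botCorner (L : Front) (slab : ℕ → Option (Fin L.word.length)) (c c' : Chord) :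
    List L.Generator :=
  if h : ∃ q : L.Generator, slab c'.pos = some q.1 ∧
      ∃ k, L.word.get q.1 = .crossing k ∧ BotCornerAt k c c' then [h.choose] else []

/-- For a sequence of chords running from right to left: the convex corners at the top, read from
right to left, then the word `t`, then the convex corners at the bottom, read from left to right. -/
noncomputable def cornerWord (L : Front) (slab : ℕ → Option (Fin L.word.length))
    (t : List L.Generator) : List Chord → List L.Generator
  | c :: c' :: Λ => L.topCorner slab c c' ++ L.cornerWord slab t (c' :: Λ) ++ L.botCorner slab c c'
  | [_] => t
  | [] => t

/-- The singularity between the lines in gap `g` and gap `g + 1`. -/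
def slab (L : Front) (g : ℕ) : Option (Fin L.word.length) :=
  if h : g < L.word.length then some ⟨g, h⟩ else none

/-- The local forms of an admissible disk between two consecutive vertical lines, away from its
originating and terminating singularities; `c` is its intersection with the right line and `c'` its
intersection with the left one.  Its boundary follows the strands of `L`, except that it may turn at
a convex corner; cusps may only be met by the interior of the disk. -/
def DiskStep (L : Front) (c c' : Chord) : Prop :=
  c.pos = c'.pos + 1 ∧
  match L.word[c'.pos]? with
  | some (.crossing k) => SmoothAt k c c' ∨ TopCornerAt k c c' ∨ BotCornerAt k c c'
  | some (.leftCusp k) => c.top = shift k c'.top ∧ c.bot = shift k c'.bot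
  | some (.rightCusp k) => c'.top = shift k c.top ∧ c'.bot = shift k c.bot
  | none => False

/-- An admissible disk on a nearly plat front, originating at the crossing or right cusp `a`: an
immersed disk with boundary on `L`, with one originating singularity (the disk fills the quadrant to
the left of the crossing `a`, resp. the inside of the right cusp `a`), one terminating singularity
(the disk fills the inside of a left cusp), and otherwise only convex corners (the disk fills the
upper or the lower quadrant of a crossing).  With these local forms the `x`-coordinate on the disk
has its maximum at the originating singularity, its minimum at the terminating singularity and no
other critical point, so that each vertical line strictly in between meets the disk in one segment
with endpoints on strands of `L`.  The disk is recorded, up to diffeomorphism, by these segments over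
the lines in the gaps of `L`, listed from right to left. -/
structure IsAdmissibleDisk (L : Front) (a : L.Generator) (D : List Chord) : Prop where
  chord : ∀ c ∈ D, c.top < c.bot ∧ c.bot < L.strands c.pos
  originates : ∃ k, (L.word.get a.1 = .crossing k ∨ L.word.get a.1 = .rightCusp k) ∧
    D.head? = some ⟨a.1, k, k + 1⟩
  step : D.IsChain L.DiskStep
  terminates : ∃ g k, L.word[g]? = some (.leftCusp k) ∧ D.getLast? = some ⟨g + 1, k, k + 1⟩

/-- The word `w(D)`: the convex corners of `D` in counter-clockwise order along the boundary,
starting at the originating singularity. -/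
noncomputable def diskWord (L : Front) (D : List Chord) : List L.Generator :=
  L.cornerWord L.slab [] D

/-- The set `Δ(a, w)` of admissible disks originating at `a` with word `w`. -/
def disks (L : Front) (a : L.Generator) (w : List L.Generator) : Set (List Chord) :=
  {D | L.IsAdmissibleDisk a D ∧ L.diskWord D = w}

/-- There are only finitely many admissible disks. -/
theorem finite_disks (L : Front) :
    {D : List Chord | ∃ a, L.IsAdmissibleDisk a D}.Finite := by
  refine (finite_chordSeq L.strands L.word.length (fun m hm => ?_) L.DiskStep
    (fun c c' h => h.1)).subset (fun D hD => ?_)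
  · have h := L.closed
    simpa [strands, strandCount, List.take_of_length_le hm] using h
  · obtain ⟨a, ha⟩ := hD
    exact ⟨ha.chord, ha.step⟩

open Classical in
/-- The Chekanov–Eliashberg differential on generators. -/
noncomputable def ceGen (L : Front) (a : L.Generator) : L.Alg :=
  (if ∃ k, L.word.get a.1 = .rightCusp k then 1 else 0) +
    ∑ᶠ w : List L.Generator, ((L.disks a w).ncard : ZMod 2) • monomial w

/-- The Chekanov–Eliashberg differential `∂` on `𝒜(L)`. -/
noncomputable def ceDiff (L : Front) : L.Alg →ₗ[ZMod 2] L.Alg := leibnizExt L.ceGen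

/-- The algebra map `ε : 𝒜(L) → ℤ/2` is an augmentation of `(𝒜(L), ∂)`. -/
def IsAugmentation {L : Front} (μ : L.MaslovPotential) (ε : L.Alg →ₐ[ZMod 2] ZMod 2) : Prop :=
  (∀ x, ε (L.ceDiff x) = 0) ∧ ∀ q : L.Generator, ε (FreeAlgebra.ι (ZMod 2) q) = 1 → degree μ q = 0

/-- The algebra map `φ^ε` with `φ^ε (q) = q + ε (q)` on generators. -/
noncomputable def phiHom {L : Front} (ε : L.Alg →ₐ[ZMod 2] ZMod 2) : L.Alg →ₐ[ZMod 2] L.Alg :=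
  FreeAlgebra.lift (ZMod 2) (fun q =>
    FreeAlgebra.ι (ZMod 2) q + algebraMap (ZMod 2) L.Alg (ε (FreeAlgebra.ι (ZMod 2) q)))

theorem phiHom_comp_self {L : Front} (ε : L.Alg →ₐ[ZMod 2] ZMod 2) :
    (phiHom ε).comp (phiHom ε) = AlgHom.id (ZMod 2) L.Alg := by
  ext q
  have h : ∀ z : ZMod 2, z + z = 0 := by decide
  simp only [phiHom, Function.comp_apply, AlgHom.comp_apply, FreeAlgebra.lift_ι_apply, map_add,
    AlgHom.commutes, add_assoc, AlgHom.id_apply]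
  rw [← map_add, h, map_zero, add_zero]

/-- `φ^ε` as an automorphism (over `ℤ/2` it is its own inverse). -/
noncomputable def phi {L : Front} (ε : L.Alg →ₐ[ZMod 2] ZMod 2) : L.Alg ≃ₐ[ZMod 2] L.Alg :=
  AlgEquiv.ofAlgHom (phiHom ε) (phiHom ε) (phiHom_comp_self ε) (phiHom_comp_self ε)

/-- The differential `∂^ε = φ^ε ∂ (φ^ε)⁻¹`. -/
noncomputable def augDiff (L : Front) (ε : L.Alg →ₐ[ZMod 2] ZMod 2) : L.Alg →ₗ[ZMod 2] L.Alg :=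
  (phi ε).toLinearMap ∘ₗ L.ceDiff ∘ₗ (phi ε).symm.toLinearMap

end Front

/-- The free algebra over `ℤ/2` on `Q` together with degrees of the generators and a linear
endomorphism (the differential). -/
structure DiffGradedFreeAlgebra (Q : Type) where
  degree : Q → ℤ
  diff : FreeAlgebra (ZMod 2) Q →ₗ[ZMod 2] FreeAlgebra (ZMod 2) Q

/-- The graded algebra `𝒜(L)` with the differential `∂^ε`. -/
noncomputable def Front.augDGA {L : Front} (μ : L.MaslovPotential)
    (ε : L.Alg →ₐ[ZMod 2] ZMod 2) : DiffGradedFreeAlgebra L.Generator where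
  degree := Front.degree μ
  diff := L.augDiff ε

/-! ### Morse complex sequences -/

/-- The vector space over `ℤ/2` with basis `e_0, …, e_{s-1}`. -/
abbrev Space (s : ℕ) : Type := Fin s →₀ ZMod 2

/-- The basis vector `e_i` (and `0` if `i` is out of range). -/
noncomputable def basisVec (s i : ℕ) : Space s :=
  if h : i < s then Finsupp.single ⟨i, h⟩ 1 else 0

/-- The coefficient `⟨d e_i, e_j⟩` (and `0` if `i` or `j` is out of range). -/
noncomputable def coeff {s : ℕ} (d : Space s →ₗ[ZMod 2] Space s) (i j : ℕ) : ZMod 2 :=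
  if h : j < s then d (basisVec s i) ⟨j, h⟩ else 0

/-- The linear map with `e_i ↦ e_{f i}`. -/
noncomputable def indexMap (s s' : ℕ) (f : ℕ → ℕ) : Space s →ₗ[ZMod 2] Space s' :=
  Finsupp.linearCombination (ZMod 2) (fun i : Fin s => basisVec s' (f i))

/-- The handleslide map `h_{k,l}`: `e_k ↦ e_k + e_l`, and `e_i ↦ e_i` for `i ≠ k`. -/
noncomputable def handleslideMap (s s' k l : ℕ) : Space s →ₗ[ZMod 2] Space s' :=
  Finsupp.linearCombination (ZMod 2) (fun i : Fin s =>
    if (i : ℕ) = k then basisVec s' k + basisVec s' l else basisVec s' i)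

/-- `f` is an isomorphism of complexes from `(Space s, d)` to `(Space s', d')`. -/
def IsComplexIso {s s' : ℕ} (f : Space s →ₗ[ZMod 2] Space s')
    (d : Space s →ₗ[ZMod 2] Space s) (d' : Space s' →ₗ[ZMod 2] Space s') : Prop :=
  Function.Bijective f ∧ ∀ v, f (d v) = d' (f v)

/-- The map `e_i ↦ [e_{shift k i}]` is an isomorphism of complexes from `(Space s, d)` to the
quotient of `(Space s', d')` by the subcomplex spanned by `e_k` and `d' e_k`.  (The differential of
the quotient is `[v] ↦ [d' v]`.) -/
def IsCuspIso {s s' : ℕ} (k : ℕ)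
    (d : Space s →ₗ[ZMod 2] Space s) (d' : Space s' →ₗ[ZMod 2] Space s') : Prop :=
  let S : Submodule (ZMod 2) (Space s') :=
    Submodule.span (ZMod 2) {basisVec s' k, d' (basisVec s' k)}
  Function.Bijective (S.mkQ ∘ₗ indexMap s s' (shift k)) ∧
    ∀ v, S.mkQ (indexMap s s' (shift k) (d v)) = S.mkQ (d' (indexMap s s' (shift k) v))

/-- An elementary marked tangle: a vertical strip containing either one singularity of the front
(with the given number) or one handleslide mark between the strands `k` and `l`. -/
inductive Tangle (N : ℕ)
  | sing (q : Fin N)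
  | handleslide (k l : ℕ)

/-- The number of the singularity in the tangle, if there is one. -/
def Tangle.sing? {N : ℕ} : Tangle N → Option (Fin N)
  | .sing q => some q
  | .handleslide _ _ => none

/-- A front together with a collection of handleslide marks, cut into elementary marked tangles by
vertical lines.  Tangle number `m` lies between the vertical lines number `m` and `m + 1`.  The
lines number `0` and `tangles.length` lie to the left and to the right of the front. -/
structure MarkedFront (L : Front) where
  tangles : List (Tangle L.word.length)
  sings : tangles.filterMap Tangle.sing? = List.finRange L.word.length

namespace MarkedFront

variable {L : Front}

/-- The gap of `L` that contains the vertical line number `m`. -/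
def gap (H : MarkedFront L) (m : ℕ) : ℕ :=
  ((H.tangles.take m).filterMap Tangle.sing?).length

/-- The number of strands over the vertical line number `m`. -/
def strands (H : MarkedFront L) (m : ℕ) : ℕ := L.strands (H.gap m)

/-- The singularity, if there is one, between the vertical lines number `m` and `m + 1`. -/
def slab (H : MarkedFront L) (m : ℕ) : Option (Fin L.word.length) :=
  H.tangles[m]?.bind Tangle.sing?

end MarkedFront

/-- A Morse complex sequence for the front `L` with Maslov potential `μ`.  The complex over the line
number `m` is `Space (strands m)` with the differential `d m`, where `e_i` has degree `μ (e_i)`; over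
the outermost lines, which do not meet `L`, it is zero. -/
structure MCS (L : Front) (μ : L.MaslovPotential) extends MarkedFront L where
  /-- All but the outermost vertical lines meet the front. -/
  meets : ∀ m, 0 < m → m < tangles.length → 0 < toMarkedFront.strands m
  /-- A handleslide mark connects two strands with the same Maslov potential. -/
  handleslide_mark : ∀ m k l, tangles[m]? = some (.handleslide k l) →
    k < l ∧ l < toMarkedFront.strands m ∧
      μ.val (toMarkedFront.gap m) k = μ.val (toMarkedFront.gap m) l
  d : ∀ m, Space (toMarkedFront.strands m) →ₗ[ZMod 2] Space (toMarkedFront.strands m)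
  d_comp_d : ∀ m v, d m (d m v) = 0
  d_degree : ∀ m i j, coeff (d m) i j ≠ 0 →
    μ.val (toMarkedFront.gap m) j = μ.val (toMarkedFront.gap m) i - 1
  d_triangular : ∀ m i j, coeff (d m) i j ≠ 0 → i < j
  crossing : ∀ m q k, tangles[m]? = some (.sing q) → L.word.get q = .crossing k →
    coeff (d m) k (k + 1) = 0 ∧
      IsComplexIso (indexMap _ _ (Equiv.swap k (k + 1))) (d m) (d (m + 1))
  leftCusp : ∀ m q k, tangles[m]? = some (.sing q) → L.word.get q = .leftCusp k →
    coeff (d (m + 1)) k (k + 1) = 1 ∧ IsCuspIso k (d m) (d (m + 1))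
  rightCusp : ∀ m q k, tangles[m]? = some (.sing q) → L.word.get q = .rightCusp k →
    coeff (d m) k (k + 1) = 1 ∧ IsCuspIso k (d (m + 1)) (d m)
  handleslide : ∀ m k l, tangles[m]? = some (.handleslide k l) →
    IsComplexIso (handleslideMap _ _ k l) (d m) (d (m + 1))

namespace MCS

variable {L : Front} {μ : L.MaslovPotential}

/-- There are no implicit handleslide marks at left cusps. -/
def IsSimple (C : MCS L μ) : Prop :=
  ∀ m q k, C.tangles[m]? = some (.sing q) → L.word.get q = .leftCusp k →
    (∀ i < k, coeff (C.d (m + 1)) i (k + 1) = 0) ∧ ∀ j > k + 1, coeff (C.d (m + 1)) k j = 0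

/-- `C` is in `A`-form: it is simple, and each handleslide mark is located immediately to the left
of a crossing and connects the two strands which cross there.  (So each crossing has at most one
mark.) -/
def IsAForm (C : MCS L μ) : Prop :=
  C.IsSimple ∧ ∀ m k l, C.tangles[m]? = some (.handleslide k l) →
    l = k + 1 ∧ ∃ q, C.tangles[m + 1]? = some (.sing q) ∧ L.word.get q = .crossing k

/-- The crossing `q` is marked: there is a handleslide mark immediately to the left of it. -/
def IsMarked (C : MCS L μ) (q : L.Generator) : Prop :=
  (∃ k, L.word.get q.1 = .crossing k) ∧
    ∃ m k l, C.tangles[m]? = some (.handleslide k l) ∧ C.tangles[m + 1]? = some (.sing q.1)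

open Classical in
/-- The algebra map `𝒜(L) → ℤ/2` which is `1` on marked crossings and `0` on all other
generators. -/
noncomputable def augmentation (C : MCS L μ) : L.Alg →ₐ[ZMod 2] ZMod 2 :=
  FreeAlgebra.lift (ZMod 2) (fun q => if C.IsMarked q then 1 else 0)

/-- The allowed successive chords of a chord path with convex corners: `c` is a chord and `c'` is
the next chord to the left of it.  (A chord path does not pass left cusps, as `L` is nearly plat.) -/
def ChordStep (C : MCS L μ) (c c' : Chord) : Prop :=
  c.pos = c'.pos + 1 ∧
  match C.tangles[c'.pos]? with
  | some (.sing q) =>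
    match L.word.get q with
    | .crossing k => SmoothAt k c c' ∨ TopCornerAt k c c' ∨ BotCornerAt k c c'
    | .leftCusp _ => False
    | .rightCusp k => c'.top = shift k c.top ∧ c'.bot = shift k c.bot
  | some (.handleslide k l) =>
    (c'.top = c.top ∧ c'.bot = c.bot) ∨
    (c.top = k ∧ l < c.bot ∧ c'.top = l ∧ c'.bot = c.bot) ∨
    (c.bot = l ∧ c.top < k ∧ c'.top = c.top ∧ c'.bot = k)
  | none => False

/-- `Λ` is a chord path with convex corners which originates at the crossing or right cusp `a` and
terminates at the crossing `b`. -/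
structure IsChordPath (C : MCS L μ) (a b : L.Generator) (Λ : List Chord) : Prop where
  chord : ∀ c ∈ Λ, c.top < c.bot ∧ c.bot < C.strands c.pos
  originates : ∃ m k, C.tangles[m]? = some (.sing a.1) ∧
    (L.word.get a.1 = .crossing k ∨ L.word.get a.1 = .rightCusp k) ∧
    Λ.head? = some ⟨m, k, k + 1⟩
  step : Λ.IsChain C.ChordStep
  terminates : ∃ p k, C.tangles[p]? = some (.sing b.1) ∧ L.word.get b.1 = .crossing k ∧
    ((∃ i, Λ.getLast? = some ⟨p + 1, i, k⟩ ∧ coeff (C.d p) i k = 1) ∨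
      (∃ j, Λ.getLast? = some ⟨p + 1, k + 1, j⟩ ∧ coeff (C.d p) (k + 1) j = 1))

/-- The set `ℳ^C(a; b_1, …, b_n)` of chord paths with convex corners which originate at `a` and
have the word `w = b_1 ⋯ b_n`: the convex corners at the top from right to left, then the crossing
where the path terminates, then the convex corners at the bottom from left to right. -/
def chordPaths (C : MCS L μ) (a : L.Generator) (w : List L.Generator) : Set (List Chord) :=
  {Λ | ∃ b, C.IsChordPath a b Λ ∧ L.cornerWord C.slab [b] Λ = w}

/-- There are only finitely many chord paths. -/
theorem finite_chordPaths (C : MCS L μ) :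
    {Λ : List Chord | ∃ a b, C.IsChordPath a b Λ}.Finite := by
  refine (finite_chordSeq C.strands C.tangles.length (fun m hm => ?_) C.ChordStep
    (fun c c' h => h.1)).subset (fun D hD => ?_)
  · have h := L.closed
    have h2 : C.gap m = L.word.length := by
      simp [MarkedFront.gap, List.take_of_length_le hm, C.sings]
    simpa [MarkedFront.strands, Front.strands, h2] using h
  · obtain ⟨a, b, ha⟩ := hD
    exact ⟨ha.chord, ha.step⟩

/-- The differential of the MCS-DGA on generators. -/
noncomputable def diffGen (C : MCS L μ) (a : L.Generator) : L.Alg :=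
  ∑ᶠ (w : List L.Generator) (_ : 1 ≤ w.length ∧ Front.wordDegree μ w = Front.degree μ a - 1),
    ((C.chordPaths a w).ncard : ZMod 2) • Front.monomial w

/-- The differential `d` of the MCS-DGA. -/
noncomputable def diff (C : MCS L μ) : L.Alg →ₗ[ZMod 2] L.Alg := leibnizExt C.diffGen

/-- The MCS-DGA `(𝒜_C, d)`: the tensor algebra on the crossings and right cusps, graded by the
Maslov potential, with the differential `d`. -/
noncomputable def dga (C : MCS L μ) : DiffGradedFreeAlgebra L.Generator where
  degree := Front.degree μ
  diff := C.diff

end MCS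

end Legendrian

/-!
Cutting an admissible disk, or a chord path, at its right-most vertical line gives a recursion for
the sum `D [i, j]` of the words of the disks, or of the chord paths, which start at the chord
`[i, j]`. At a crossing with generator `q` of the strands `k` and `k + 1` both recursions have the
same shape `x ↦ crossStep k q x`. Let `F` be the sum over chord paths plus the coefficients of the
MCS, which are the contributions of the disks whose last steps have no convex corner. Then `F`
satisfies the recursion at a crossing as well, the terminal chords of chord paths accounting for the
coefficients.

A handleslide mark immediately to the left of the crossing turns `crossStep k q` into
`crossStep k (q + 1)`, and `q + 1 = φ^ε q` for a marked crossing. At a left cusp simplicity gives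
`F` the same initial values as `D`. So `F = φ^ε D` up to the right cusps. There the MCS only
satisfies the recursion up to a product of two coefficients of the differential, which vanishes for
the chords `[2n, 2n + 1]` because one of its factors is a coefficient of the same kind with
endpoints in the wrong order. These are the only chords which are needed since the right cusps are
not nested. Hence `d q = φ^ε ∂ q` on generators. As `d` has no constant term, neither has `φ^ε ∂ q`,
and this constant term is `ε (∂ q)`.
-/

namespace Legendrian

theorem finsum_ncard_fiber {α β R M : Type*} [Semiring R] [AddCommMonoid M] [Module R M]
    {A : Set α} (hA : A.Finite) (f : α → β) (g : β → M) :
    ∑ᶠ w : β, (({a | a ∈ A ∧ f a = w} : Set α).ncard : R) • g w = ∑ᶠ a ∈ A, g (f a) := by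
  classical
  lift A to Finset α using hA
  have fiber_eq (w : β) : ({a | a ∈ (A : Set α) ∧ f a = w} : Set α) = A.filter (f · = w) := by
    ext a
    simp
  simp only [fiber_eq, Set.ncard_coe_finset, Nat.cast_smul_eq_nsmul]
  have support_subset :
      Function.support (fun w => (A.filter (f · = w)).card • g w) ⊆ A.image f := by
    intro w hw
    obtain ⟨a, ha⟩ := Finset.card_ne_zero.1 (left_ne_zero_of_smul hw)
    exact Finset.mem_coe.2 (Finset.mem_image.2 ⟨a, Finset.mem_filter.1 ha⟩)
  rw [finsum_mem_coe_finset, finsum_eq_sum_of_support_subset _ support_subset, Finset.sum_comp]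

open Classical in
theorem dite_choose_eq_ite {α : Type*} {p : α → Prop} {a : α} (h : ∀ b, p b → b = a) :
    (if hp : ∃ b, p b then [hp.choose] else []) = if p a then [a] else [] := by
  split_ifs with hp ha ha
  · rw [h _ hp.choose_spec]
  · obtain ⟨b, hb⟩ := hp
    exact absurd (h b hb ▸ hb) ha
  · exact absurd ⟨a, ha⟩ hp
  · rfl

namespace Front

variable {L : Front}

theorem monomial_nil : monomial ([] : List L.Generator) = 1 := rfl

theorem monomial_singleton (q : L.Generator) : monomial [q] = FreeAlgebra.ι (ZMod 2) q := by
  simp [monomial]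

theorem monomial_append (v w : List L.Generator) :
    monomial (v ++ w) = monomial v * monomial w := by
  simp [monomial]

variable {μ : L.MaslovPotential}

theorem wordDegree_nil : wordDegree μ [] = 0 := rfl

theorem wordDegree_singleton (q : L.Generator) : wordDegree μ [q] = degree μ q := by
  simp [wordDegree]

theorem wordDegree_append (v w : List L.Generator) :
    wordDegree μ (v ++ w) = wordDegree μ v + wordDegree μ w := by
  simp [wordDegree]

/-- A crossing as a generator. -/
def crossingGen (q : Fin L.word.length) {k : ℕ} (hk : L.word.get q = .crossing k) :
    L.Generator := ⟨q, Or.inl ⟨k, hk⟩⟩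

section Corners

variable {slab : ℕ → Option (Fin L.word.length)} {c c' : Chord} {q : Fin L.word.length} {k : ℕ}

theorem slab_crossing_iff (hs : slab c'.pos = some q) (hk : L.word.get q = .crossing k)
    {P : ℕ → Prop} {b : L.Generator} :
    (slab c'.pos = some b.1 ∧ ∃ k, L.word.get b.1 = .crossing k ∧ P k) ↔
      b = crossingGen q hk ∧ P k := by
  rw [hs, Option.some.injEq]
  constructor
  · rintro ⟨rfl, k', hk', hP⟩
    obtain rfl : k = k' := Singularity.crossing.inj (hk.symm.trans hk')
    exact ⟨rfl, hP⟩
  · rintro ⟨rfl, hP⟩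
    exact ⟨rfl, k, hk, hP⟩

open Classical in
theorem topCorner_crossing (hs : slab c'.pos = some q) (hk : L.word.get q = .crossing k) :
    L.topCorner slab c c' = if TopCornerAt k c c' then [crossingGen q hk] else [] := by
  unfold topCorner
  simp only [slab_crossing_iff hs hk]
  rw [dite_choose_eq_ite (a := crossingGen q hk) fun b hb => hb.1]
  simp only [true_and]

open Classical in
theorem botCorner_crossing (hs : slab c'.pos = some q) (hk : L.word.get q = .crossing k) :
    L.botCorner slab c c' = if BotCornerAt k c c' then [crossingGen q hk] else [] := by
  unfold botCorner
  simp only [slab_crossing_iff hs hk]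
  rw [dite_choose_eq_ite (a := crossingGen q hk) fun b hb => hb.1]
  simp only [true_and]

theorem topCorner_eq_nil (h : ∀ q, slab c'.pos = some q → ∀ k, L.word.get q ≠ .crossing k) :
    L.topCorner slab c c' = [] :=
  dif_neg fun ⟨_, hq, k, hk, _⟩ => h _ hq k hk

theorem botCorner_eq_nil (h : ∀ q, slab c'.pos = some q → ∀ k, L.word.get q ≠ .crossing k) :
    L.botCorner slab c c' = [] :=
  dif_neg fun ⟨_, hq, k, hk, _⟩ => h _ hq k hk

end Corners

end Front

/-! ### Sums over chord sequences -/

/-- The common data of admissible disks and of chord paths: the number of strands over each vertical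
line, the singularities between successive lines, the allowed steps to the left, and the chords at
which a sequence may terminate together with the word `final` contributed there. -/
structure ChordSystem (L : Front) where
  strands : ℕ → ℕ
  strands_eq_zero : ∃ N, ∀ m, N ≤ m → strands m = 0
  slab : ℕ → Option (Fin L.word.length)
  step : Chord → Chord → Prop
  step_pos : ∀ c c', step c c' → c.pos = c'.pos + 1
  terminal : Chord → Prop
  final : Chord → List L.Generator

namespace ChordSystem

variable {L : Front} (X : ChordSystem L)

/-- The chord `c` joins two strands, in the right order. -/
def Valid (c : Chord) : Prop := c.top < c.bot ∧ c.bot < X.strands c.pos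

/-- The complete chord sequences which start with the chord `c`. -/
def pathsFrom (c : Chord) : Set (List Chord) :=
  {Λ | (∀ e ∈ Λ, X.Valid e) ∧ Λ.head? = some c ∧ Λ.IsChain X.step ∧
    ∃ e, Λ.getLast? = some e ∧ X.terminal e}

/-- The word of a chord sequence, as for `Front.cornerWord`, except that the word in the middle is
determined by the last chord. -/
noncomputable def word : List Chord → List L.Generator
  | c :: c' :: Λ => L.topCorner X.slab c c' ++ word (c' :: Λ) ++ L.botCorner X.slab c c'
  | [c] => X.final c
  | [] => []

/-- The sum of the words of the chord sequences which start with `c`. -/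
noncomputable def pathSum (c : Chord) : L.Alg :=
  ∑ᶠ Λ ∈ X.pathsFrom c, Front.monomial (X.word Λ)

theorem finite_pathsFrom (c : Chord) : (X.pathsFrom c).Finite := by
  obtain ⟨N, hN⟩ := X.strands_eq_zero
  exact (finite_chordSeq X.strands N hN X.step X.step_pos).subset fun _ h => ⟨h.1, h.2.2.1⟩

theorem cornerWord_eq_word {Λ : List Chord} {e : Chord} (h : Λ.getLast? = some e) :
    L.cornerWord X.slab (X.final e) Λ = X.word Λ := by
  induction Λ with
  | nil => simp at h
  | cons c Λ ih =>
    cases Λ with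
    | nil =>
      obtain rfl : c = e := by simpa using h
      rfl
    | cons c' Λ =>
      rw [List.getLast?_cons_cons] at h
      rw [Front.cornerWord, word, ih h]

variable {X} {c c' e : Chord} {Λ : List Chord}

theorem nil_notMem_pathsFrom : [] ∉ X.pathsFrom c := by
  simp [pathsFrom]

theorem singleton_mem_pathsFrom : [c] ∈ X.pathsFrom e ↔ c = e ∧ X.Valid c ∧ X.terminal c := by
  simp [pathsFrom, and_left_comm]

theorem cons_cons_mem_pathsFrom :
    c :: c' :: Λ ∈ X.pathsFrom e ↔
      c = e ∧ X.Valid c ∧ X.step c c' ∧ c' :: Λ ∈ X.pathsFrom c' := by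
  simp only [pathsFrom, Set.mem_ofPred_eq, List.forall_mem_cons, List.head?_cons, Option.some.injEq,
    List.isChain_cons_cons, List.getLast?_cons_cons]
  tauto

theorem eq_cons_of_mem_pathsFrom (h : Λ ∈ X.pathsFrom c) : ∃ Λ', Λ = c :: Λ' :=
  List.head?_eq_some_iff.1 h.2.1

open Classical in
theorem pathsFrom_eq (hc : X.Valid c) :
    X.pathsFrom c = (if X.terminal c then {[c]} else ∅) ∪
      ⋃ c' ∈ {c' | X.step c c'}, List.cons c '' X.pathsFrom c' := by
  ext Λ
  rcases Λ with _ | ⟨x, _ | ⟨y, Λ⟩⟩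
  · split_ifs <;> simp [nil_notMem_pathsFrom]
  · split_ifs with h <;>
      simp +contextual [singleton_mem_pathsFrom, nil_notMem_pathsFrom, iff_def, h, hc]
  · have head_eq {e : Chord} (h : y :: Λ ∈ X.pathsFrom e) : y = e := by
      obtain ⟨Λ', h⟩ := eq_cons_of_mem_pathsFrom h
      exact (List.cons.inj h).1
    have single : x :: y :: Λ ∉ (if X.terminal c then {[c]} else ∅ : Set (List Chord)) := by
      split_ifs <;> simp
    simp only [cons_cons_mem_pathsFrom, Set.mem_union, single, false_or, Set.mem_iUnion,
      Set.mem_ofPred_eq, Set.mem_image, List.cons.injEq, exists_prop]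
    constructor
    · rintro ⟨rfl, -, hstep, hΛ⟩
      exact ⟨y, hstep, _, hΛ, rfl, rfl⟩
    · rintro ⟨e, hstep, _, hΛ, rfl, rfl⟩
      obtain rfl := head_eq hΛ
      exact ⟨rfl, hc, hstep, hΛ⟩

theorem finsum_cons_image_pathsFrom :
    ∑ᶠ Λ ∈ List.cons c '' X.pathsFrom c', Front.monomial (X.word Λ) =
      Front.monomial (L.topCorner X.slab c c') * X.pathSum c' *
        Front.monomial (L.botCorner X.slab c c') := by
  rw [finsum_mem_image List.cons_injective.injOn, pathSum,
    mul_finsum_mem' _ _ (X.finite_pathsFrom c'), finsum_mem_mul' _ _ (X.finite_pathsFrom c')]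
  refine finsum_mem_congr rfl fun Λ hΛ => ?_
  obtain ⟨Λ, rfl⟩ := eq_cons_of_mem_pathsFrom hΛ
  rw [word, Front.monomial_append, Front.monomial_append]

open Classical in
theorem pathSum_eq (hc : X.Valid c) (s : Finset Chord) (hs : ∀ c', X.step c c' ↔ c' ∈ s) :
    X.pathSum c = (if X.terminal c then Front.monomial (X.final c) else 0) +
      ∑ c' ∈ s, Front.monomial (L.topCorner X.slab c c') * X.pathSum c' *
        Front.monomial (L.botCorner X.slab c c') := by
  have successors : {c' | X.step c c'} = s := Set.ext hs
  have finite_image : ∀ c' ∈ (s : Set Chord), (List.cons c '' X.pathsFrom c').Finite :=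
    fun c' _ => (X.finite_pathsFrom c').image _
  have disjoint_terminal : Disjoint (if X.terminal c then {[c]} else ∅ : Set (List Chord))
      (⋃ c' ∈ (s : Set Chord), List.cons c '' X.pathsFrom c') := by
    split_ifs <;> simp [nil_notMem_pathsFrom]
  have disjoint_images : (s : Set Chord).PairwiseDisjoint
      fun c' => List.cons c '' X.pathsFrom c' := by
    refine fun c₁ _ c₂ _ hne => Set.disjoint_image_of_injective List.cons_injective ?_
    exact Set.disjoint_left.2 fun Λ h₁ h₂ => hne (Option.some.inj (h₁.2.1.symm.trans h₂.2.1))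
  rw [pathSum, pathsFrom_eq hc, successors, finsum_mem_union disjoint_terminal
    (by split_ifs <;> simp) (s.finite_toSet.biUnion finite_image),
    finsum_mem_biUnion disjoint_images s.finite_toSet finite_image, finsum_mem_coe_finset]
  congr 1
  · split_ifs
    · rw [finsum_mem_singleton, word]
    · rw [finsum_mem_empty]
  · exact Finset.sum_congr rfl fun c' _ => finsum_cons_image_pathsFrom

open Classical in
theorem pathSum_succ {g i j : ℕ} (hc : X.Valid ⟨g + 1, i, j⟩) (s : Finset (ℕ × ℕ))
    (hs : ∀ a b, X.step ⟨g + 1, i, j⟩ ⟨g, a, b⟩ ↔ (a, b) ∈ s) :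
    X.pathSum ⟨g + 1, i, j⟩ =
      (if X.terminal ⟨g + 1, i, j⟩ then Front.monomial (X.final ⟨g + 1, i, j⟩) else 0) +
      ∑ p ∈ s, Front.monomial (L.topCorner X.slab ⟨g + 1, i, j⟩ ⟨g, p.1, p.2⟩) *
        X.pathSum ⟨g, p.1, p.2⟩ *
        Front.monomial (L.botCorner X.slab ⟨g + 1, i, j⟩ ⟨g, p.1, p.2⟩) := by
  have chord_injective : Function.Injective fun p : ℕ × ℕ => Chord.mk g p.1 p.2 := by
    rintro ⟨a, b⟩ ⟨a', b'⟩ h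
    simpa using h
  rw [pathSum_eq hc (s.image fun p => ⟨g, p.1, p.2⟩), Finset.sum_image chord_injective.injOn]
  rintro ⟨p, a, b⟩
  simp only [Finset.mem_image, Chord.mk.injEq, Prod.exists]
  constructor
  · intro h
    obtain rfl : g = p := Nat.succ_injective (X.step_pos _ _ h)
    exact ⟨a, b, (hs _ _).1 h, rfl, rfl, rfl⟩
  · rintro ⟨_, _, h, rfl, rfl, rfl⟩
    exact (hs _ _).2 h

open Classical in
theorem pathSum_of_not_crossing {g i j : ℕ}
    (hg : ∀ q, X.slab g = some q → ∀ k, L.word.get q ≠ .crossing k)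
    (hc : X.Valid ⟨g + 1, i, j⟩) (s : Finset (ℕ × ℕ))
    (hs : ∀ a b, X.step ⟨g + 1, i, j⟩ ⟨g, a, b⟩ ↔ (a, b) ∈ s) :
    X.pathSum ⟨g + 1, i, j⟩ =
      (if X.terminal ⟨g + 1, i, j⟩ then Front.monomial (X.final ⟨g + 1, i, j⟩) else 0) +
      ∑ p ∈ s, X.pathSum ⟨g, p.1, p.2⟩ := by
  rw [pathSum_succ hc s hs]
  simp only [Front.topCorner_eq_nil (c' := ⟨g, _, _⟩) hg,
    Front.botCorner_eq_nil (c' := ⟨g, _, _⟩) hg, Front.monomial_nil, one_mul, mul_one]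

theorem wordDegree_word {μ : L.MaslovPotential} {δ : Chord → ℤ}
    (hterm : ∀ c, X.Valid c → X.terminal c → Front.wordDegree μ (X.final c) = δ c)
    (hstep : ∀ c c', X.Valid c → X.step c c' →
      Front.wordDegree μ (L.topCorner X.slab c c') + δ c' +
        Front.wordDegree μ (L.botCorner X.slab c c') = δ c)
    (hΛ : Λ ∈ X.pathsFrom c) : Front.wordDegree μ (X.word Λ) = δ c := by
  induction Λ generalizing c with
  | nil => exact absurd hΛ nil_notMem_pathsFrom
  | cons x Λ ih =>
    cases Λ with
    | nil =>
      obtain ⟨rfl, valid, terminal⟩ := singleton_mem_pathsFrom.1 hΛ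
      exact hterm _ valid terminal
    | cons c' Λ =>
      obtain ⟨rfl, valid, step, tail_mem⟩ := cons_cons_mem_pathsFrom.1 hΛ
      rw [word, Front.wordDegree_append, Front.wordDegree_append, ih tail_mem]
      exact hstep _ _ valid step

end ChordSystem

/-- The effect of a crossing of the strands `k` and `k + 1` on the sums over chord sequences, where
each convex corner at the crossing contributes the factor `x`. -/
def crossStep {A : Type*} [Semiring A] (k : ℕ) (x : A) (f : ℕ → ℕ → A) (i j : ℕ) : A :=
  (if i = k ∧ j = k + 1 then 0 else f (Equiv.swap k (k + 1) i) (Equiv.swap k (k + 1) j)) +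
    (if i = k + 1 then x * f (k + 1) j else 0) + (if j = k then f i k * x else 0)

/-- The endpoints of the chords which may follow `[i, j]` at a crossing of the strands `k` and
`k + 1`. -/
def crossingSuccessors (k i j : ℕ) : Finset (ℕ × ℕ) :=
  (if i = k ∧ j = k + 1 then ∅ else {(Equiv.swap k (k + 1) i, Equiv.swap k (k + 1) j)}) ∪
    (if i = k + 1 then {(k + 1, j)} else ∅) ∪ (if j = k then {(i, k)} else ∅)

theorem sum_crossingSuccessors {M : Type*} [AddCommMonoid M] {i j : ℕ} (k : ℕ) (hij : i < j)
    (f : ℕ × ℕ → M) :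
    ∑ p ∈ crossingSuccessors k i j, f p =
      (if i = k ∧ j = k + 1 then 0 else f (Equiv.swap k (k + 1) i, Equiv.swap k (k + 1) j)) +
        (if i = k + 1 then f (k + 1, j) else 0) + (if j = k then f (i, k) else 0) := by
  rw [crossingSuccessors, Finset.sum_union, Finset.sum_union]
  · congr 2
    all_goals split_ifs <;> simp
  · split_ifs with h₁ h₂ <;> simp [*]
  · split_ifs with h₁ h₂ h₃ <;> simp [*]; omega

theorem mem_crossingSuccessors {k i j g a b : ℕ} :
    (a, b) ∈ crossingSuccessors k i j ↔ SmoothAt k ⟨g + 1, i, j⟩ ⟨g, a, b⟩ ∨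
      TopCornerAt k ⟨g + 1, i, j⟩ ⟨g, a, b⟩ ∨ BotCornerAt k ⟨g + 1, i, j⟩ ⟨g, a, b⟩ := by
  simp only [crossingSuccessors, Finset.mem_union, or_assoc, SmoothAt, TopCornerAt, BotCornerAt]
  refine or_congr ?_ (or_congr ?_ ?_) <;> split_ifs with h <;> simp [h, and_comm]

open Classical in
theorem ChordSystem.pathSum_crossing {L : Front} {X : ChordSystem L} {g i j k : ℕ}
    {q : Fin L.word.length} (hg : X.slab g = some q) (hk : L.word.get q = .crossing k)
    (hc : X.Valid ⟨g + 1, i, j⟩)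
    (hstep : ∀ a b, X.step ⟨g + 1, i, j⟩ ⟨g, a, b⟩ ↔ (a, b) ∈ crossingSuccessors k i j) :
    X.pathSum ⟨g + 1, i, j⟩ =
      (if X.terminal ⟨g + 1, i, j⟩ then Front.monomial (X.final ⟨g + 1, i, j⟩) else 0) +
      crossStep k (FreeAlgebra.ι (ZMod 2) (Front.crossingGen q hk))
        (fun i j => X.pathSum ⟨g, i, j⟩) i j := by
  have hij : i < j := hc.1
  have smooth_top : ¬ TopCornerAt k ⟨g + 1, i, j⟩
      ⟨g, Equiv.swap k (k + 1) i, Equiv.swap k (k + 1) j⟩ := by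
    rintro ⟨rfl, h, -⟩
    simp at h
  have smooth_bot : ¬ BotCornerAt k ⟨g + 1, i, j⟩
      ⟨g, Equiv.swap k (k + 1) i, Equiv.swap k (k + 1) j⟩ := by
    rintro ⟨rfl, h, -⟩
    simp at h
  rw [pathSum_succ hc _ hstep, sum_crossingSuccessors k hij, crossStep]
  simp only [Front.topCorner_crossing (c' := ⟨g, _, _⟩) hg hk,
    Front.botCorner_crossing (c' := ⟨g, _, _⟩) hg hk, smooth_top, smooth_bot, if_false,
    Front.monomial_nil, one_mul, mul_one]
  refine congrArg _ (congrArg₂ _ (congrArg _ ?_) ?_)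
  · refine ite_congr rfl (fun h => ?_) fun _ => rfl
    simp [TopCornerAt, BotCornerAt, h, show j ≠ k by omega, Front.monomial_nil,
      Front.monomial_singleton]
  · refine ite_congr rfl (fun h => ?_) fun _ => rfl
    simp [TopCornerAt, BotCornerAt, h, show i ≠ k + 1 by omega, Front.monomial_nil,
      Front.monomial_singleton]

/-! ### Renumbering of strands -/

section Shift

variable {k i j s : ℕ}

theorem shift_of_lt (h : i < k) : shift k i = i := if_pos h

theorem shift_of_le (h : k ≤ i) : shift k i = i + 2 := if_neg (by omega)

theorem shift_injective (k : ℕ) : Function.Injective (shift k) := by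
  intro i j h
  unfold shift at h
  split_ifs at h <;> omega

theorem shift_ne_self (k i : ℕ) : shift k i ≠ k := by
  unfold shift
  split_ifs <;> omega

theorem shift_ne_succ (k i : ℕ) : shift k i ≠ k + 1 := by
  unfold shift
  split_ifs <;> omega

theorem exists_shift_eq (h : i ≠ k) (h' : i ≠ k + 1) : ∃ j, shift k j = i := by
  by_cases hi : i < k
  · exact ⟨i, shift_of_lt hi⟩
  · exact ⟨i - 2, by rw [shift_of_le (by omega)]; omega⟩

theorem shift_lt_shift : shift k i < shift k j ↔ i < j := by
  unfold shift
  split_ifs <;> omega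

theorem shift_lt_add_two (h : k ≤ s) : shift k i < s + 2 ↔ i < s := by
  unfold shift
  split_ifs <;> omega

theorem even_shift (hi : Even i) : Even (shift k i) := by
  unfold shift
  split_ifs
  exacts [hi, hi.add even_two]

theorem shift_succ_of_even (hk : Even k) (hi : Even i) : shift k (i + 1) = shift k i + 1 := by
  have := Nat.even_iff.1 hk
  have := Nat.even_iff.1 hi
  unfold shift
  split_ifs <;> omega

theorem swap_succ_lt (h : k + 1 < s) : Equiv.swap k (k + 1) i < s ↔ i < s := by
  rw [Equiv.swap_apply_def]
  split_ifs <;> omega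

end Shift

/-! ### Coefficients of differentials -/

section Coefficients

variable {s s' : ℕ}

theorem basisVec_val (i : Fin s) : basisVec s i = Finsupp.single i 1 := by
  simp [basisVec]

theorem basisVec_apply (i j : ℕ) (hj : j < s) :
    basisVec s i ⟨j, hj⟩ = if i = j then 1 else 0 := by
  unfold basisVec
  split_ifs with h1 h2 h2
  · subst h2
    exact Finsupp.single_eq_same
  · exact Finsupp.single_eq_of_ne (by simpa [eq_comm] using h2)
  · exact absurd (h2 ▸ hj) h1
  · rfl

theorem coeff_of_lt (d : Space s →ₗ[ZMod 2] Space s) (i : ℕ) {j : ℕ} (hj : j < s) :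
    coeff d i j = d (basisVec s i) ⟨j, hj⟩ := dif_pos hj

theorem coeff_of_le (d : Space s →ₗ[ZMod 2] Space s) (i : ℕ) {j : ℕ} (hj : s ≤ j) :
    coeff d i j = 0 := dif_neg hj.not_gt

theorem apply_eq_sum_coeff (d : Space s →ₗ[ZMod 2] Space s) (v : Space s) {j : ℕ} (hj : j < s) :
    d v ⟨j, hj⟩ = ∑ i : Fin s, v i * coeff d i j := by
  conv_lhs => rw [← Finsupp.univ_sum_single v]
  rw [map_sum, Finsupp.finsetSum_apply]
  refine Finset.sum_congr rfl fun i _ => ?_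
  rw [coeff_of_lt d _ hj, basisVec_val, ← smul_eq_mul, ← Finsupp.smul_apply, ← map_smul,
    Finsupp.smul_single, smul_eq_mul, mul_one]

theorem sum_coeff_mul_coeff {d : Space s →ₗ[ZMod 2] Space s} (hd : ∀ v, d (d v) = 0) (i j : ℕ) :
    ∑ l ∈ Finset.range s, coeff d i l * coeff d l j = 0 := by
  rcases lt_or_ge j s with hj | hj
  · rw [← Fin.sum_univ_eq_sum_range fun l => coeff d i l * coeff d l j]
    simp only [coeff_of_lt d i (Fin.is_lt _), ← apply_eq_sum_coeff d _ hj, hd, Finsupp.zero_apply]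
  · simp only [coeff_of_le d _ hj, mul_zero, Finset.sum_const_zero]

theorem coeff_eq_zero_of_row_eq_single {d : Space s →ₗ[ZMod 2] Space s}
    (hd : ∀ v, d (d v) = 0) {k l : ℕ} (hkl : coeff d k l = 1)
    (hrow : ∀ j ≠ l, coeff d k j = 0) (j : ℕ) : coeff d l j = 0 := by
  have h := sum_coeff_mul_coeff hd k j
  rw [Finset.sum_eq_single l (fun i _ hi => by rw [hrow i hi, zero_mul])
    (fun hl => by rw [coeff_of_le d k (by simpa using hl), zero_mul]), hkl, one_mul] at h
  exact h

theorem coeff_eq_zero_of_column_eq_single {d : Space s →ₗ[ZMod 2] Space s}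
    (hd : ∀ v, d (d v) = 0) {k l : ℕ} (hkl : coeff d k l = 1)
    (hcol : ∀ i ≠ k, coeff d i l = 0) (i : ℕ) : coeff d i k = 0 := by
  have h := sum_coeff_mul_coeff hd i l
  rw [Finset.sum_eq_single k (fun j _ hj => by rw [hcol j hj, mul_zero])
    (fun hk => by rw [coeff_of_le d i (by simpa using hk), zero_mul]), hkl, mul_one] at h
  exact h

theorem indexMap_basisVec (f : ℕ → ℕ) {i : ℕ} (hi : i < s) :
    indexMap s s' f (basisVec s i) = basisVec s' (f i) := by
  simp [basisVec, hi, indexMap]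

theorem indexMap_apply (f : ℕ → ℕ) (v : Space s) {j : ℕ} (hj : j < s') :
    indexMap s s' f v ⟨j, hj⟩ = ∑ i : Fin s, if f i = j then v i else 0 := by
  rw [indexMap, Finsupp.linearCombination_apply, Finsupp.sum_fintype _ _ (by simp)]
  simp [Finsupp.finsetSum_apply, basisVec_apply]

theorem indexMap_apply_of_injective {f : ℕ → ℕ} (hf : Function.Injective f) (v : Space s) {j : ℕ}
    (hj : j < s) (hj' : f j < s') : indexMap s s' f v ⟨f j, hj'⟩ = v ⟨j, hj⟩ := by
  rw [indexMap_apply, Finset.sum_eq_single ⟨j, hj⟩]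
  · exact if_pos rfl
  · exact fun i _ hi => if_neg fun h => hi (Fin.ext (hf h))
  · exact fun h => absurd (Finset.mem_univ _) h

theorem indexMap_apply_of_ne {f : ℕ → ℕ} {j : ℕ} (h : ∀ i, f i ≠ j) (v : Space s) (hj : j < s') :
    indexMap s s' f v ⟨j, hj⟩ = 0 := by
  simp [indexMap_apply, h]

theorem handleslideMap_basisVec (k l : ℕ) {i : ℕ} (hi : i < s) :
    handleslideMap s s' k l (basisVec s i) =
      if i = k then basisVec s' k + basisVec s' l else basisVec s' i := by
  simp [basisVec, hi, handleslideMap]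

theorem handleslideMap_apply {k l : ℕ} (hk : k < s) (v : Space s) {j : ℕ} (hj : j < s)
    (hj' : j < s') :
    handleslideMap s s' k l v ⟨j, hj'⟩ = v ⟨j, hj⟩ + if j = l then v ⟨k, hk⟩ else 0 := by
  have summand (i : Fin s) : (v i • (if (i : ℕ) = k then basisVec s' k + basisVec s' l
      else basisVec s' i)) ⟨j, hj'⟩ =
      (if i = ⟨j, hj⟩ then v i else 0) + if i = ⟨k, hk⟩ then (if j = l then v i else 0) else 0 := by
    simp only [Fin.ext_iff, Finsupp.smul_apply, smul_eq_mul]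
    by_cases h1 : (i : ℕ) = k
    · simp only [h1, if_true, Finsupp.add_apply, basisVec_apply, mul_add]
      simp [eq_comm]
    · simp [h1, basisVec_apply]
  rw [handleslideMap, Finsupp.linearCombination_apply, Finsupp.sum_fintype _ _ (by simp),
    Finsupp.finsetSum_apply, Finset.sum_congr rfl fun i _ => summand i, Finset.sum_add_distrib]
  simp

variable {d : Space s →ₗ[ZMod 2] Space s} {d' : Space s' →ₗ[ZMod 2] Space s'}

theorem coeff_eq_of_indexMap {f : ℕ → ℕ} (hf : Function.Injective f)
    (h : IsComplexIso (indexMap s s' f) d d') {i j : ℕ} (hi : i < s) (hj : j < s)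
    (hj' : f j < s') : coeff d' (f i) (f j) = coeff d i j := by
  have h1 := congrArg (fun v => v ⟨f j, hj'⟩) (h.2 (basisVec s i))
  simp only [indexMap_basisVec f hi, indexMap_apply_of_injective hf _ hj hj'] at h1
  rw [coeff_of_lt _ _ hj', coeff_of_lt _ _ hj, h1]

theorem coeff_handleslide {k l : ℕ} (h : IsComplexIso (handleslideMap s s' k l) d d') {i j : ℕ}
    (hss : s' = s) (hk : k < s) (hi : i < s) (hj : j < s) :
    coeff d i j + (if j = l then coeff d i k else 0) =
      coeff d' i j + if i = k then coeff d' l j else 0 := by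
  subst hss
  have h1 := congrArg (fun v => v ⟨j, hj⟩) (h.2 (basisVec s' i))
  simp only [handleslideMap_basisVec k l hi, handleslideMap_apply hk _ hj hj] at h1
  rw [coeff_of_lt d i hj, coeff_of_lt d i hk, coeff_of_lt d' i hj, coeff_of_lt d' l hj, h1]
  split_ifs with hik
  · rw [map_add, Finsupp.add_apply, hik]
  · rw [add_zero]

theorem coeff_cusp {k : ℕ} (h : IsCuspIso k d d') (hkk : coeff d' k k = 0)
    (hk1 : coeff d' k (k + 1) = 1) (hss : s' = s + 2) (hk : k ≤ s) {i j : ℕ} (hi : i < s)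
    (hj : j < s) :
    coeff d i j = coeff d' (shift k i) (shift k j) +
      coeff d' (shift k i) (k + 1) * coeff d' k (shift k j) := by
  subst hss
  have hjs : shift k j < s + 2 := (shift_lt_add_two hk).2 hj
  have hk1s : k + 1 < s + 2 := by omega
  have mem_span := h.2 (basisVec s i)
  simp only [Submodule.mkQ_apply, Submodule.Quotient.eq, indexMap_basisVec (shift k) hi]
    at mem_span
  obtain ⟨a, b, hab⟩ := Submodule.mem_span_pair.1 mem_span
  have at_succ := congrArg (fun v => v ⟨k + 1, hk1s⟩) hab
  have at_shift := congrArg (fun v => v ⟨shift k j, hjs⟩) hab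
  simp only [Finsupp.add_apply, Finsupp.smul_apply, Finsupp.sub_apply, smul_eq_mul,
    indexMap_apply_of_ne (shift_ne_succ k), indexMap_apply_of_injective (shift_injective k) _ hj,
    basisVec_apply, ← coeff_of_lt, hk1] at at_succ at_shift
  rw [if_neg (by omega), CharTwo.sub_eq_add] at at_succ
  rw [if_neg (shift_ne_self k j).symm, CharTwo.sub_eq_add] at at_shift
  simp only [mul_zero, zero_add, mul_one] at at_succ at_shift
  rw [← at_succ, at_shift, add_comm, add_assoc, CharTwo.add_self_eq_zero, add_zero]

end Coefficients

/-! ### Sums over admissible disks -/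

namespace Front

variable {L : Front} {g i j k : ℕ} {q : Fin L.word.length} {t : Singularity}

theorem getElem?_of_get (h : L.word.get q = t) : L.word[(q : ℕ)]? = some t := by
  rw [← h]
  simp

theorem strands_of_length_le (h : L.word.length ≤ g) : L.strands g = 0 := by
  simpa only [strands, strandCount, List.take_of_length_le h, List.take_length] using L.closed

theorem strands_succ (h : L.word[g]? = some t) :
    L.strands (g + 1) = t.strandsAfter (L.strands g) := by
  simp [strands, strandCount, List.take_add_one, h]

theorem fits_of_getElem? (h : L.word[g]? = some t) : t.Fits (L.strands g) := by
  obtain ⟨hg, rfl⟩ := List.getElem?_eq_some_iff.1 h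
  exact L.fits g hg

theorem slab_eq (q : Fin L.word.length) : L.slab q = some q := by
  simp [slab]

theorem eq_of_slab_eq_some (h : L.slab g = some q) : g = q := by
  unfold slab at h
  split_ifs at h with hg
  exact congrArg Fin.val (Option.some.inj h)

theorem ne_crossing_of_slab (ht : L.word[g]? = some t) (hne : ∀ k, t ≠ .crossing k)
    (q : Fin L.word.length) (hq : L.slab g = some q) (k : ℕ) : L.word.get q ≠ .crossing k := by
  intro hk
  obtain rfl := eq_of_slab_eq_some hq
  exact hne k (Option.some.inj (ht.symm.trans (getElem?_of_get hk)))

theorem eq_of_crossing_or_rightCusp {l : ℕ} (hk : t = .crossing k ∨ t = .rightCusp k)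
    (hl : t = .crossing l ∨ t = .rightCusp l) : k = l := by
  rcases hk with rfl | rfl <;> simpa using hl

/-- The chord sequences which record admissible disks. -/
noncomputable def diskSystem (L : Front) : ChordSystem L where
  strands := L.strands
  strands_eq_zero := ⟨_, fun _ => strands_of_length_le⟩
  slab := L.slab
  step := L.DiskStep
  step_pos _ _ h := h.1
  terminal c := ∃ g k, L.word[g]? = some (.leftCusp k) ∧ c = ⟨g + 1, k, k + 1⟩
  final _ := []

/-- The sum of the words of the left parts of admissible disks which start with the chord `[i, j]`
over the line in gap `g`. -/
noncomputable def diskSum (L : Front) (g i j : ℕ) : L.Alg := L.diskSystem.pathSum ⟨g, i, j⟩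

theorem isAdmissibleDisk_iff {a : L.Generator} {D : List Chord}
    (hk : L.word.get a.1 = .crossing k ∨ L.word.get a.1 = .rightCusp k) :
    L.IsAdmissibleDisk a D ↔ D ∈ L.diskSystem.pathsFrom ⟨a.1, k, k + 1⟩ := by
  constructor
  · rintro ⟨chord, ⟨l, hl, head⟩, step, g, n, cusp, last⟩
    obtain rfl := eq_of_crossing_or_rightCusp hk hl
    exact ⟨chord, head, step, _, last, g, n, cusp, rfl⟩
  · rintro ⟨chord, head, step, _, last, g, n, cusp, rfl⟩
    exact ⟨chord, ⟨k, hk, head⟩, step, g, n, cusp, last⟩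

theorem diskWord_eq {c : Chord} {D : List Chord} (h : D ∈ L.diskSystem.pathsFrom c) :
    L.diskWord D = L.diskSystem.word D := by
  obtain ⟨-, -, -, e, last, -⟩ := h
  exact L.diskSystem.cornerWord_eq_word last

theorem mem_disks_iff {a : L.Generator} {w : List L.Generator} {D : List Chord}
    (hk : L.word.get a.1 = .crossing k ∨ L.word.get a.1 = .rightCusp k) :
    D ∈ L.disks a w ↔
      D ∈ L.diskSystem.pathsFrom ⟨a.1, k, k + 1⟩ ∧ L.diskSystem.word D = w := by
  rw [disks, Set.mem_ofPred_eq, isAdmissibleDisk_iff hk]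
  exact and_congr_right fun h => by rw [diskWord_eq h]

open Classical in
theorem ceGen_eq {a : L.Generator}
    (hk : L.word.get a.1 = .crossing k ∨ L.word.get a.1 = .rightCusp k) :
    L.ceGen a = (if ∃ k, L.word.get a.1 = .rightCusp k then 1 else 0) +
      L.diskSum a.1 k (k + 1) := by
  have disks_eq (w : List L.Generator) : L.disks a w =
      {D | D ∈ L.diskSystem.pathsFrom ⟨a.1, k, k + 1⟩ ∧ L.diskSystem.word D = w} :=
    Set.ext fun D => mem_disks_iff hk
  rw [ceGen, diskSum, ChordSystem.pathSum,
    ← finsum_ncard_fiber (R := ZMod 2) (L.diskSystem.finite_pathsFrom _) L.diskSystem.word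
      monomial]
  simp only [disks_eq]

/-- The local forms of an admissible disk at the singularity `t`. -/
def DiskStepAt (t : Singularity) (c c' : Chord) : Prop :=
  match t with
  | .crossing k => SmoothAt k c c' ∨ TopCornerAt k c c' ∨ BotCornerAt k c c'
  | .leftCusp k => c.top = shift k c'.top ∧ c.bot = shift k c'.bot
  | .rightCusp k => c'.top = shift k c.top ∧ c'.bot = shift k c.bot

theorem diskStep_iff (ht : L.word[g]? = some t) {a b : ℕ} :
    L.diskSystem.step ⟨g + 1, i, j⟩ ⟨g, a, b⟩ ↔ DiskStepAt t ⟨g + 1, i, j⟩ ⟨g, a, b⟩ := by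
  simp only [diskSystem, DiskStep, ht, true_and]
  cases t <;> rfl

theorem diskSystem_terminal_iff (ht : L.word[g]? = some t) :
    L.diskSystem.terminal ⟨g + 1, i, j⟩ ↔ t = .leftCusp i ∧ j = i + 1 := by
  simp only [diskSystem, Chord.mk.injEq, Nat.add_right_cancel_iff]
  constructor
  · rintro ⟨_, _, cusp, rfl, rfl, rfl⟩
    exact ⟨Option.some.inj (ht.symm.trans cusp), rfl⟩
  · rintro ⟨rfl, rfl⟩
    exact ⟨g, i, ht, rfl, rfl, rfl⟩

theorem diskSum_crossing (hk : L.word.get q = .crossing k) (hij : i < j)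
    (hj : j < L.strands (q + 1)) :
    L.diskSum (q + 1) i j =
      crossStep k (FreeAlgebra.ι (ZMod 2) (crossingGen q hk)) (L.diskSum q) i j := by
  have hq := getElem?_of_get hk
  have not_terminal : ¬ L.diskSystem.terminal ⟨q + 1, i, j⟩ := by simp [diskSystem_terminal_iff hq]
  rw [diskSum, ChordSystem.pathSum_crossing (slab_eq q) hk ⟨hij, hj⟩
    fun a b => (diskStep_iff hq).trans mem_crossingSuccessors.symm, if_neg not_terminal, zero_add]
  rfl

open Classical in
theorem diskSum_of_ne_crossing (ht : L.word[g]? = some t) (hne : ∀ k, t ≠ .crossing k)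
    (hij : i < j) (hj : j < L.strands (g + 1)) (s : Finset (ℕ × ℕ))
    (hs : ∀ a b, DiskStepAt t ⟨g + 1, i, j⟩ ⟨g, a, b⟩ ↔ (a, b) ∈ s) :
    L.diskSum (g + 1) i j =
      (if t = .leftCusp i ∧ j = i + 1 then 1 else 0) + ∑ p ∈ s, L.diskSum g p.1 p.2 := by
  rw [diskSum, ChordSystem.pathSum_of_not_crossing (ne_crossing_of_slab ht hne) ⟨hij, hj⟩ s
    fun a b => (diskStep_iff ht).trans (hs a b)]
  simp only [diskSystem_terminal_iff ht]
  rfl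

theorem diskSum_leftCusp_self (hk : L.word[g]? = some (.leftCusp k)) :
    L.diskSum (g + 1) k (k + 1) = 1 := by
  have hf : k ≤ L.strands g := fits_of_getElem? hk
  have hs : L.strands (g + 1) = L.strands g + 2 := strands_succ hk
  rw [diskSum_of_ne_crossing hk (by simp) k.lt_succ_self (by omega) ∅]
  · simp
  · intro a b
    simp [DiskStepAt, (shift_ne_self k a).symm]

theorem diskSum_leftCusp_shift (hk : L.word[g]? = some (.leftCusp k)) (hij : i < j)
    (hj : j < L.strands g) : L.diskSum (g + 1) (shift k i) (shift k j) = L.diskSum g i j := by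
  have hs : L.strands (g + 1) = L.strands g + 2 := strands_succ hk
  have hj' : shift k j < L.strands (g + 1) := by rwa [hs, shift_lt_add_two (fits_of_getElem? hk)]
  rw [diskSum_of_ne_crossing hk (by simp) (shift_lt_shift.2 hij) hj' {(i, j)}]
  · simp [(shift_ne_self k i).symm]
  · intro a b
    simp [DiskStepAt, (shift_injective k).eq_iff, eq_comm]

theorem diskSum_leftCusp_of_eq (hk : L.word[g]? = some (.leftCusp k)) (hij : i < j)
    (hj : j < L.strands (g + 1)) (hne : i ≠ k ∨ j ≠ k + 1)
    (h : i = k ∨ i = k + 1 ∨ j = k ∨ j = k + 1) : L.diskSum (g + 1) i j = 0 := by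
  rw [diskSum_of_ne_crossing hk (by simp) hij hj ∅]
  · rw [if_neg, zero_add, Finset.sum_empty]
    rintro ⟨hki, rfl⟩
    obtain rfl := Singularity.leftCusp.inj hki
    simp at hne
  · simp only [DiskStepAt, Finset.notMem_empty, iff_false]
    rintro a b ⟨rfl, rfl⟩
    rcases h with h | h | h | h
    exacts [shift_ne_self _ _ h, shift_ne_succ _ _ h, shift_ne_self _ _ h, shift_ne_succ _ _ h]

theorem diskSum_rightCusp (hk : L.word[g]? = some (.rightCusp k)) (hij : i < j)
    (hj : j < L.strands (g + 1)) :
    L.diskSum (g + 1) i j = L.diskSum g (shift k i) (shift k j) := by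
  rw [diskSum_of_ne_crossing hk (by simp) hij hj {(shift k i, shift k j)}]
  · simp
  · intro a b
    simp [DiskStepAt]

variable (μ : L.MaslovPotential) {a : L.Generator}

theorem degree_crossing (h : L.word.get a.1 = .crossing k) :
    degree μ a = μ.val a.1 k - μ.val a.1 (k + 1) := by
  simp only [degree, h]

theorem degree_rightCusp (h : L.word.get a.1 = .rightCusp k) : degree μ a = 1 := by
  simp only [degree, h]

end Front

/-! ### Sums over chord paths -/

namespace MarkedFront

variable {L : Front} (H : MarkedFront L) {m m' k l : ℕ} {q : Fin L.word.length} {t : Singularity}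

theorem gap_succ {t : Tangle L.word.length} (h : H.tangles[m]? = some t) :
    H.gap (m + 1) = H.gap m + t.sing?.toList.length := by
  cases t <;> simp [gap, List.take_add_one, h, Tangle.sing?]

theorem gap_succ_handleslide (h : H.tangles[m]? = some (.handleslide k l)) :
    H.gap (m + 1) = H.gap m :=
  H.gap_succ h

theorem gap_mono (h : m ≤ m') : H.gap m ≤ H.gap m' :=
  ((List.take_sublist_take_left h).filterMap _).length_le

theorem gap_eq (h : H.tangles[m]? = some (.sing q)) : H.gap m = q := by
  obtain ⟨hm, hq⟩ := List.getElem?_eq_some_iff.1 h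
  have split_sings : (H.tangles.take m).filterMap Tangle.sing? ++
      q :: (H.tangles.drop (m + 1)).filterMap Tangle.sing? = List.finRange L.word.length := by
    rw [← H.sings]
    conv_rhs => rw [← List.take_append_drop m H.tangles, List.drop_eq_getElem_cons hm, hq]
    rw [List.filterMap_append, List.filterMap_cons]
    rfl
  have getElem_gap : (List.finRange L.word.length)[H.gap m]? = some q := by
    rw [← split_sings, gap, List.getElem?_append_right le_rfl]
    simp
  obtain ⟨_, rfl⟩ := List.getElem?_eq_some_iff.1 getElem_gap
  simp

theorem gap_succ_eq (h : H.tangles[m]? = some (.sing q)) : H.gap (m + 1) = q + 1 := by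
  rw [H.gap_succ h, H.gap_eq h]
  rfl

theorem tangle_unique (h : H.tangles[m]? = some (.sing q)) (h' : H.tangles[m']? = some (.sing q)) :
    m = m' := by
  have not_before {a b : ℕ} (ha : H.tangles[a]? = some (Tangle.sing q))
      (hb : H.tangles[b]? = some (Tangle.sing q)) : ¬ a < b := by
    intro hab
    have gap_le := H.gap_mono (Nat.succ_le_of_lt hab)
    rw [H.gap_eq hb, Nat.succ_eq_add_one, H.gap_succ_eq ha] at gap_le
    omega
  exact le_antisymm (not_lt.1 (not_before h' h)) (not_lt.1 (not_before h h'))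

theorem exists_tangle (q : Fin L.word.length) : ∃ m : ℕ, H.tangles[m]? = some (.sing q) := by
  have mem_sings : q ∈ H.tangles.filterMap Tangle.sing? := H.sings ▸ List.mem_finRange q
  obtain ⟨t, ht, htq⟩ := List.mem_filterMap.1 mem_sings
  cases t with
  | handleslide k l => exact absurd htq (by simp [Tangle.sing?])
  | sing q' =>
    obtain rfl : q' = q := Option.some.inj htq
    exact List.mem_iff_getElem?.1 ht

theorem exists_tangle_of_succ {t : Tangle L.word.length} (h : H.tangles[m + 1]? = some t) :
    ∃ t', H.tangles[m]? = some t' := by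
  obtain ⟨hm, -⟩ := List.getElem?_eq_some_iff.1 h
  exact ⟨H.tangles[m], List.getElem?_eq_getElem (by omega)⟩

theorem slab_eq (h : H.tangles[m]? = some (.sing q)) : H.slab m = some q := by
  simp [slab, h, Tangle.sing?]

theorem slab_handleslide (h : H.tangles[m]? = some (.handleslide k l)) : H.slab m = none := by
  simp [slab, h, Tangle.sing?]

theorem ne_crossing_of_slab (h : H.tangles[m]? = some (.sing q))
    (hq : ∀ k, L.word.get q ≠ .crossing k) (q' : Fin L.word.length) (hq' : H.slab m = some q') :
    ∀ k, L.word.get q' ≠ .crossing k :=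
  Option.some.inj ((H.slab_eq h).symm.trans hq') ▸ hq

theorem ne_crossing_of_slab_handleslide (h : H.tangles[m]? = some (.handleslide k l))
    (q : Fin L.word.length) (hq : H.slab m = some q) (k : ℕ) : L.word.get q ≠ .crossing k :=
  absurd ((H.slab_handleslide h).symm.trans hq) (Option.some_ne_none q).symm

theorem strands_succ (h : H.tangles[m]? = some (.sing q)) (ht : L.word.get q = t) :
    H.strands (m + 1) = t.strandsAfter (H.strands m) := by
  rw [strands, H.gap_succ_eq h, Front.strands_succ (Front.getElem?_of_get ht), strands, H.gap_eq h]

theorem fits (h : H.tangles[m]? = some (.sing q)) (ht : L.word.get q = t) :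
    t.Fits (H.strands m) := by
  rw [strands, H.gap_eq h]
  exact Front.fits_of_getElem? (Front.getElem?_of_get ht)

theorem strands_handleslide (h : H.tangles[m]? = some (.handleslide k l)) :
    H.strands (m + 1) = H.strands m := by
  rw [strands, H.gap_succ_handleslide h, strands]

theorem strands_of_length_le (h : H.tangles.length ≤ m) : H.strands m = 0 := by
  have gap_eq_length : H.gap m = L.word.length := by
    simp [gap, List.take_of_length_le h, H.sings]
  rw [strands, gap_eq_length]
  exact Front.strands_of_length_le le_rfl

end MarkedFront

namespace MCS

variable {L : Front} {μ : L.MaslovPotential} (C : MCS L μ) {m i j i' j' k l : ℕ}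
  {q : Fin L.word.length}

theorem coeff_eq_zero_of_le (h : j ≤ i) : coeff (C.d m) i j = 0 :=
  of_not_not fun hne => (C.d_triangular m i j hne).not_ge h

theorem chordStep_crossing (h : C.tangles[m]? = some (.sing q)) (hk : L.word.get q = .crossing k) :
    C.ChordStep ⟨m + 1, i, j⟩ ⟨m, i', j'⟩ ↔ SmoothAt k ⟨m + 1, i, j⟩ ⟨m, i', j'⟩ ∨
      TopCornerAt k ⟨m + 1, i, j⟩ ⟨m, i', j'⟩ ∨ BotCornerAt k ⟨m + 1, i, j⟩ ⟨m, i', j'⟩ := by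
  simp only [ChordStep, h, hk, true_and]

theorem not_chordStep_leftCusp (h : C.tangles[m]? = some (.sing q))
    (hk : L.word.get q = .leftCusp k) : ¬ C.ChordStep ⟨m + 1, i, j⟩ ⟨m, i', j'⟩ := by
  simp only [ChordStep, h, hk, and_false, not_false_eq_true]

theorem chordStep_rightCusp (h : C.tangles[m]? = some (.sing q))
    (hk : L.word.get q = .rightCusp k) :
    C.ChordStep ⟨m + 1, i, j⟩ ⟨m, i', j'⟩ ↔ i' = shift k i ∧ j' = shift k j := by
  simp only [ChordStep, h, hk, true_and]

theorem chordStep_handleslide (h : C.tangles[m]? = some (.handleslide k l)) :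
    C.ChordStep ⟨m + 1, i, j⟩ ⟨m, i', j'⟩ ↔ (i' = i ∧ j' = j) ∨
      (i = k ∧ l < j ∧ i' = l ∧ j' = j) ∨ (j = l ∧ i < k ∧ i' = i ∧ j' = k) := by
  simp only [ChordStep, h, true_and]

/-- A chord path may terminate at the crossing `b` with the chord `c`. -/
def TerminatesAt (b : L.Generator) (c : Chord) : Prop :=
  ∃ p k, C.tangles[p]? = some (.sing b.1) ∧ L.word.get b.1 = .crossing k ∧ c.pos = p + 1 ∧
    ((c.bot = k ∧ coeff (C.d p) c.top k = 1) ∨ (c.top = k + 1 ∧ coeff (C.d p) (k + 1) c.bot = 1))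

theorem terminatesAt_iff {b : L.Generator} (h : C.tangles[m]? = some (.sing q)) :
    C.TerminatesAt b ⟨m + 1, i, j⟩ ↔ b.1 = q ∧ ∃ k, L.word.get q = .crossing k ∧
      ((j = k ∧ coeff (C.d m) i k = 1) ∨ (i = k + 1 ∧ coeff (C.d m) (k + 1) j = 1)) := by
  constructor
  · rintro ⟨p, k, hp, hk, hpos, hd⟩
    obtain rfl : m = p := Nat.succ_injective hpos
    obtain rfl : q = b.1 := Tangle.sing.inj (Option.some.inj (h.symm.trans hp))
    exact ⟨rfl, k, hk, hd⟩
  · rintro ⟨rfl, k, hk, hd⟩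
    exact ⟨m, k, h, hk, rfl, hd⟩

theorem TerminatesAt.unique {C : MCS L μ} {b b' : L.Generator} {c : Chord}
    (h : C.TerminatesAt b c) (h' : C.TerminatesAt b' c) : b = b' := by
  obtain ⟨x, i, j⟩ := c
  obtain ⟨p, k, hp, -, rfl, -⟩ := h
  exact Subtype.ext ((C.terminatesAt_iff hp).1 h').1.symm

open Classical in
/-- The chord sequences which are chord paths with convex corners. -/
noncomputable def chordSystem : ChordSystem L where
  strands := C.strands
  strands_eq_zero := ⟨_, fun _ => C.strands_of_length_le⟩
  slab := C.slab
  step := C.ChordStep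
  step_pos _ _ h := h.1
  terminal c := ∃ b, C.TerminatesAt b c
  final c := if h : ∃ b, C.TerminatesAt b c then [h.choose] else []

theorem chordSystem_final {b : L.Generator} {c : Chord} (h : C.TerminatesAt b c) :
    C.chordSystem.final c = [b] := by
  classical
  exact (dite_choose_eq_ite fun _ h' => h'.unique h).trans (if_pos h)

/-- The sum of the words of the left parts of chord paths which start with the chord `[i, j]` over
the line number `m`. -/
noncomputable def chordSum (m i j : ℕ) : L.Alg := C.chordSystem.pathSum ⟨m, i, j⟩

/-- The degree of the word of a chord path which starts with the chord `c`. -/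
def chordDegree (c : Chord) : ℤ :=
  μ.val (C.gap c.pos) c.top - μ.val (C.gap c.pos) c.bot - 1

theorem val_crossing (h : C.tangles[m]? = some (.sing q)) (hk : L.word.get q = .crossing k)
    (hi : i < C.strands (m + 1)) :
    μ.val (C.gap (m + 1)) i = μ.val (C.gap m) (Equiv.swap k (k + 1) i) := by
  have hk' := Front.getElem?_of_get hk
  have hstrands : C.strands (m + 1) = L.strands q :=
    (C.strands_succ h hk).trans (congrArg L.strands (C.gap_eq h))
  have hswap := μ.crossing q k hk' _ ((swap_succ_lt (Front.fits_of_getElem? hk')).2 (hstrands ▸ hi))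
  rw [C.gap_succ_eq h, C.gap_eq h, ← hswap, Equiv.swap_apply_self]

theorem chordDegree_crossing (h : C.tangles[m]? = some (.sing q))
    (hk : L.word.get q = .crossing k) (hc : C.chordSystem.Valid ⟨m + 1, i, j⟩) :
    C.chordDegree ⟨m + 1, i, j⟩ =
      C.chordDegree ⟨m, Equiv.swap k (k + 1) i, Equiv.swap k (k + 1) j⟩ := by
  simp only [chordDegree, C.val_crossing h hk hc.2, C.val_crossing h hk (hc.1.trans hc.2)]

theorem degree_eq_val_gap {a : L.Generator} (h : C.tangles[m]? = some (.sing a.1))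
    (hk : L.word.get a.1 = .crossing k) :
    Front.degree μ a = μ.val (C.gap m) k - μ.val (C.gap m) (k + 1) := by
  rw [Front.degree_crossing μ hk, C.gap_eq h]

theorem wordDegree_final {c : Chord} (hc : C.chordSystem.Valid c) (h : C.chordSystem.terminal c) :
    Front.wordDegree μ (C.chordSystem.final c) = C.chordDegree c := by
  obtain ⟨b, hb⟩ := h
  rw [C.chordSystem_final hb, Front.wordDegree_singleton]
  obtain ⟨x, i, j⟩ := c
  obtain ⟨p, k, hp, hk, rfl, hd⟩ := hb
  have hij : i < j := hc.1
  rw [C.chordDegree_crossing hp hk hc, chordDegree, C.degree_eq_val_gap hp hk]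
  dsimp only at hd ⊢
  rcases hd with ⟨rfl, hd⟩ | ⟨rfl, hd⟩
  · have degree_d := C.d_degree p i j (by simp [hd])
    rw [Equiv.swap_apply_left, Equiv.swap_apply_of_ne_of_ne (by omega) (by omega), degree_d]
    ring
  · have degree_d := C.d_degree p (k + 1) j (by simp [hd])
    rw [Equiv.swap_apply_right, Equiv.swap_apply_of_ne_of_ne (by omega) (by omega), degree_d]
    ring

theorem chordDegree_step_crossing (h : C.tangles[m]? = some (.sing q))
    (hk : L.word.get q = .crossing k) (hc : C.chordSystem.Valid ⟨m + 1, i, j⟩)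
    (hstep : C.ChordStep ⟨m + 1, i, j⟩ ⟨m, i', j'⟩) :
    Front.wordDegree μ (L.topCorner C.slab ⟨m + 1, i, j⟩ ⟨m, i', j'⟩) + C.chordDegree ⟨m, i', j'⟩ +
      Front.wordDegree μ (L.botCorner C.slab ⟨m + 1, i, j⟩ ⟨m, i', j'⟩) =
        C.chordDegree ⟨m + 1, i, j⟩ := by
  have hij : i < j := hc.1
  have degree_gen : Front.degree μ (Front.crossingGen q hk) =
      μ.val (C.gap m) k - μ.val (C.gap m) (k + 1) :=
    C.degree_eq_val_gap h hk
  rw [Front.topCorner_crossing (C.slab_eq h) hk, Front.botCorner_crossing (C.slab_eq h) hk,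
    C.chordDegree_crossing h hk hc]
  rcases (C.chordStep_crossing h hk).1 hstep with hsmooth | htop | hbot
  · obtain ⟨-, rfl, rfl⟩ := id hsmooth
    rw [if_neg, if_neg, Front.wordDegree_nil, zero_add, add_zero]
    · rintro ⟨rfl, hj, -⟩
      simp at hj
    · rintro ⟨rfl, hi, -⟩
      simp at hi
  · obtain ⟨rfl, rfl, rfl⟩ := id htop
    rw [if_pos htop, if_neg fun hbot => by have := hbot.1; dsimp only at *; omega,
      Front.wordDegree_singleton, Front.wordDegree_nil, degree_gen]
    dsimp only [chordDegree] at hij ⊢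
    rw [Equiv.swap_apply_right, Equiv.swap_apply_of_ne_of_ne (by omega) (by omega)]
    ring
  · obtain ⟨rfl, rfl, rfl⟩ := id hbot
    rw [if_pos hbot, if_neg fun htop => by have := htop.1; dsimp only at *; omega,
      Front.wordDegree_singleton, Front.wordDegree_nil, degree_gen]
    dsimp only [chordDegree] at hij ⊢
    rw [Equiv.swap_apply_left, Equiv.swap_apply_of_ne_of_ne (by omega) (by omega)]
    ring

theorem chordDegree_step_rightCusp (h : C.tangles[m]? = some (.sing q))
    (hk : L.word.get q = .rightCusp k) (hc : C.chordSystem.Valid ⟨m + 1, i, j⟩)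
    (hstep : C.ChordStep ⟨m + 1, i, j⟩ ⟨m, i', j'⟩) :
    C.chordDegree ⟨m, i', j'⟩ = C.chordDegree ⟨m + 1, i, j⟩ := by
  obtain ⟨rfl, rfl⟩ := (C.chordStep_rightCusp h hk).1 hstep
  have hj : j < L.strands (q + 1) := C.gap_succ_eq h ▸ hc.2
  have val_shift := (μ.rightCusp q k (Front.getElem?_of_get hk)).1
  simp only [chordDegree, C.gap_eq h, C.gap_succ_eq h, val_shift i (hc.1.trans hj),
    val_shift j hj]

theorem chordDegree_step_handleslide (h : C.tangles[m]? = some (.handleslide k l))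
    (hstep : C.ChordStep ⟨m + 1, i, j⟩ ⟨m, i', j'⟩) :
    C.chordDegree ⟨m, i', j'⟩ = C.chordDegree ⟨m + 1, i, j⟩ := by
  have val_eq := (C.handleslide_mark m k l h).2.2
  simp only [chordDegree, C.gap_succ_handleslide h]
  rcases (C.chordStep_handleslide h).1 hstep with
    ⟨rfl, rfl⟩ | ⟨rfl, -, rfl, rfl⟩ | ⟨rfl, -, rfl, rfl⟩
  · rfl
  · rw [val_eq]
  · rw [val_eq]

theorem chordDegree_step {c c' : Chord} (hc : C.chordSystem.Valid c) (hstep : C.ChordStep c c') :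
    Front.wordDegree μ (L.topCorner C.slab c c') + C.chordDegree c' +
      Front.wordDegree μ (L.botCorner C.slab c c') = C.chordDegree c := by
  obtain ⟨x, i, j⟩ := c
  obtain ⟨m, i', j'⟩ := c'
  obtain rfl : x = m + 1 := hstep.1
  rcases ht : C.tangles[m]? with _ | ⟨q⟩ | ⟨k, l⟩
  · exact absurd hstep.2 (by simp [ht])
  · rcases hk : L.word.get q with k | k | k
    · exact absurd hstep (C.not_chordStep_leftCusp ht hk)
    · exact C.chordDegree_step_crossing ht hk hc hstep
    · have hne : ∀ l, L.word.get q ≠ .crossing l := fun l => by rw [hk]; nofun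
      rw [Front.topCorner_eq_nil (C.ne_crossing_of_slab ht hne),
        Front.botCorner_eq_nil (C.ne_crossing_of_slab ht hne), Front.wordDegree_nil, zero_add,
        add_zero]
      exact C.chordDegree_step_rightCusp ht hk hc hstep
  · rw [Front.topCorner_eq_nil (C.ne_crossing_of_slab_handleslide ht),
      Front.botCorner_eq_nil (C.ne_crossing_of_slab_handleslide ht), Front.wordDegree_nil, zero_add,
      add_zero]
    exact C.chordDegree_step_handleslide ht hstep

variable {a b : L.Generator} {Λ : List Chord} {w : List L.Generator}

theorem IsChordPath.exists_terminatesAt {C : MCS L μ} (h : C.IsChordPath a b Λ) :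
    ∃ e, Λ.getLast? = some e ∧ C.TerminatesAt b e := by
  obtain ⟨p, k, hp, hk, ⟨i, last, hd⟩ | ⟨j, last, hd⟩⟩ := h.terminates
  · exact ⟨_, last, p, k, hp, hk, rfl, Or.inl ⟨rfl, hd⟩⟩
  · exact ⟨_, last, p, k, hp, hk, rfl, Or.inr ⟨rfl, hd⟩⟩

theorem mem_pathsFrom_iff (hm : C.tangles[m]? = some (.sing a.1))
    (hk : L.word.get a.1 = .crossing k ∨ L.word.get a.1 = .rightCusp k) :
    Λ ∈ C.chordSystem.pathsFrom ⟨m, k, k + 1⟩ ↔ ∃ b, C.IsChordPath a b Λ := by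
  constructor
  · rintro ⟨chord, head, step, ⟨x, i, j⟩, last, b, p, l, hp, hl, rfl, hd⟩
    refine ⟨b, chord, ⟨m, k, hm, hk, head⟩, step, p, l, hp, hl, ?_⟩
    rcases hd with ⟨rfl, hd⟩ | ⟨rfl, hd⟩
    · exact Or.inl ⟨i, last, hd⟩
    · exact Or.inr ⟨j, last, hd⟩
  · rintro ⟨b, h⟩
    obtain ⟨m', k', hm', hk', head⟩ := h.originates
    obtain rfl := Front.eq_of_crossing_or_rightCusp hk hk'
    obtain rfl := C.tangle_unique hm hm'
    obtain ⟨e, last, he⟩ := h.exists_terminatesAt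
    exact ⟨h.chord, head, h.step, e, last, b, he⟩

theorem cornerWord_eq (h : C.IsChordPath a b Λ) :
    L.cornerWord C.slab [b] Λ = C.chordSystem.word Λ := by
  obtain ⟨e, last, he⟩ := h.exists_terminatesAt
  rw [← C.chordSystem.cornerWord_eq_word last, C.chordSystem_final he]
  rfl

theorem length_le_length_cornerWord (slab : ℕ → Option (Fin L.word.length))
    (t : List L.Generator) (Λ : List Chord) : t.length ≤ (L.cornerWord slab t Λ).length := by
  induction Λ with
  | nil => rfl
  | cons c Λ ih =>
    cases Λ with
    | nil => rfl
    | cons c' Λ =>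
      rw [Front.cornerWord, List.length_append, List.length_append]
      omega

theorem mem_chordPaths_iff (hm : C.tangles[m]? = some (.sing a.1))
    (hk : L.word.get a.1 = .crossing k ∨ L.word.get a.1 = .rightCusp k) :
    Λ ∈ C.chordPaths a w ↔
      Λ ∈ C.chordSystem.pathsFrom ⟨m, k, k + 1⟩ ∧ C.chordSystem.word Λ = w := by
  rw [C.mem_pathsFrom_iff hm hk, ← exists_and_right]
  exact exists_congr fun b => and_congr_right fun h => by rw [C.cornerWord_eq h]

theorem chordDegree_generator (hm : C.tangles[m]? = some (.sing a.1))
    (hk : L.word.get a.1 = .crossing k ∨ L.word.get a.1 = .rightCusp k) :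
    C.chordDegree ⟨m, k, k + 1⟩ = Front.degree μ a - 1 := by
  rcases hk with hk | hk
  · rw [chordDegree, C.degree_eq_val_gap hm hk]
  · rw [chordDegree, C.gap_eq hm, Front.degree_rightCusp μ hk,
      (μ.rightCusp _ _ (Front.getElem?_of_get hk)).2]
    ring

theorem one_le_length_of_mem_chordPaths (h : Λ ∈ C.chordPaths a w) : 1 ≤ w.length := by
  obtain ⟨b, -, rfl⟩ := h
  exact length_le_length_cornerWord _ [b] _

theorem wordDegree_of_mem_chordPaths (h : Λ ∈ C.chordPaths a w) :
    Front.wordDegree μ w = Front.degree μ a - 1 := by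
  obtain ⟨m, k, hm, hk, -⟩ := h.choose_spec.1.originates
  obtain ⟨hΛ, rfl⟩ := (C.mem_chordPaths_iff hm hk).1 h
  rw [← C.chordDegree_generator hm hk]
  exact ChordSystem.wordDegree_word (fun _ => C.wordDegree_final)
    (fun _ _ => C.chordDegree_step) hΛ

theorem diffGen_eq_finsum (a : L.Generator) :
    C.diffGen a = ∑ᶠ w : List L.Generator, ((C.chordPaths a w).ncard : ZMod 2) •
      Front.monomial w := by
  refine finsum_congr fun w => ?_
  rcases (C.chordPaths a w).eq_empty_or_nonempty with hempty | ⟨Λ, hΛ⟩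
  · simp [hempty]
  · rw [finsum_eq_if, if_pos ⟨C.one_le_length_of_mem_chordPaths hΛ,
      C.wordDegree_of_mem_chordPaths hΛ⟩]

theorem diffGen_eq (hm : C.tangles[m]? = some (.sing a.1))
    (hk : L.word.get a.1 = .crossing k ∨ L.word.get a.1 = .rightCusp k) :
    C.diffGen a = C.chordSum m k (k + 1) := by
  have chordPaths_eq (w : List L.Generator) : C.chordPaths a w =
      {Λ | Λ ∈ C.chordSystem.pathsFrom ⟨m, k, k + 1⟩ ∧ C.chordSystem.word Λ = w} :=
    Set.ext fun Λ => C.mem_chordPaths_iff hm hk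
  rw [diffGen_eq_finsum, chordSum, ChordSystem.pathSum,
    ← finsum_ncard_fiber (R := ZMod 2) (C.chordSystem.finite_pathsFrom _) C.chordSystem.word
      Front.monomial]
  simp only [chordPaths_eq]

end MCS

/-! ### Sums over chord paths together with the coefficients of the differentials -/

section CrossStep

variable {A B : Type*} [Semiring A] [Semiring B] {k i j s : ℕ} {f f' : ℕ → ℕ → A}

theorem crossStep_add (k : ℕ) (x : A) (f f' : ℕ → ℕ → A) (i j : ℕ) :
    crossStep k x (fun i j => f i j + f' i j) i j = crossStep k x f i j + crossStep k x f' i j := by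
  simp only [crossStep, mul_add, add_mul]
  split_ifs <;> abel

theorem map_crossStep (φ : A →+* B) (k : ℕ) (x : A) (f : ℕ → ℕ → A) (i j : ℕ) :
    φ (crossStep k x f i j) = crossStep k (φ x) (fun i j => φ (f i j)) i j := by
  simp only [crossStep, map_add, apply_ite φ, map_mul, map_zero]

theorem crossStep_congr (x : A) (hk : k + 1 < s)
    (h : ∀ i j, i < j → j < s → f i j = f' i j) (hij : i < j) (hj : j < s) :
    crossStep k x f i j = crossStep k x f' i j := by
  unfold crossStep
  refine congrArg₂ _ (congrArg₂ _ ?_ ?_) ?_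
  · refine ite_congr rfl (fun _ => rfl) fun hne => h _ _ ?_ ((swap_succ_lt hk).2 hj)
    rw [Equiv.swap_apply_def, Equiv.swap_apply_def]
    split_ifs <;> omega
  · exact ite_congr rfl (fun hi => by rw [h _ _ (hi ▸ hij) hj]) fun _ => rfl
  · exact ite_congr rfl (fun hj => by rw [h _ _ (hj ▸ hij) (by omega)]) fun _ => rfl

/-- The effect of a handleslide mark between the strands `k` and `l` on the sums over chord
sequences. -/
def slideStep {A : Type*} [AddCommMonoid A] (k l : ℕ) (f : ℕ → ℕ → A) (i j : ℕ) : A :=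
  f i j + (if i = k ∧ l < j then f l j else 0) + (if j = l ∧ i < k then f i k else 0)

theorem slideStep_add (k l : ℕ) (f f' : ℕ → ℕ → A) (i j : ℕ) :
    slideStep k l (fun i j => f i j + f' i j) i j = slideStep k l f i j + slideStep k l f' i j := by
  simp only [slideStep]
  split_ifs <;> abel

theorem map_slideStep (φ : A →+* B) (k l : ℕ) (f : ℕ → ℕ → A) (i j : ℕ) :
    φ (slideStep k l f i j) = slideStep k l (fun i j => φ (f i j)) i j := by
  simp only [slideStep, map_add, apply_ite φ, map_zero]

theorem slideStep_self_succ (k : ℕ) (f : ℕ → ℕ → A) :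
    slideStep k (k + 1) f k (k + 1) = f k (k + 1) := by
  simp [slideStep]

theorem crossStep_slideStep (k : ℕ) (x : A) (f : ℕ → ℕ → A) (hij : i < j) :
    crossStep k x (slideStep k (k + 1) f) i j = crossStep k (x + 1) f i j := by
  unfold crossStep slideStep
  by_cases hi : i = k + 1
  · subst hi
    have swap_j : Equiv.swap k (k + 1) j = j :=
      Equiv.swap_apply_of_ne_of_ne (by omega) (by omega)
    simp only [swap_j, hij, show j ≠ k by omega, show j ≠ k + 1 by omega, Equiv.swap_apply_right,
      Nat.succ_ne_self, true_and, false_and, if_true, if_false, add_zero, add_mul, one_mul]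
    abel
  by_cases hj : j = k
  · subst hj
    have swap_i : Equiv.swap j (j + 1) i = i :=
      Equiv.swap_apply_of_ne_of_ne (by omega) (by omega)
    simp only [swap_i, hij, hi, show i ≠ j by omega, j.succ_ne_self.symm, Equiv.swap_apply_left,
      true_and, false_and, if_true, if_false, add_zero, mul_add, mul_one]
    abel
  · have swap_i : Equiv.swap k (k + 1) i ≠ k := by
      rwa [Ne, Equiv.swap_apply_eq_iff, Equiv.swap_apply_left]
    have swap_j : Equiv.swap k (k + 1) j ≠ k + 1 := by
      rwa [Ne, Equiv.swap_apply_eq_iff, Equiv.swap_apply_right]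
    simp only [hi, hj, swap_i, swap_j, false_and, if_false, add_zero]

end CrossStep

theorem ite_eq_one_eq_smul {M : Type*} [AddCommMonoid M] [Module (ZMod 2) M] (a : ZMod 2) (x : M) :
    (if a = 1 then x else 0) = a • x := by
  have h : a = 0 ∨ a = 1 := by
    revert a
    decide
  rcases h with rfl | rfl <;> simp

namespace MCS

variable {L : Front} {μ : L.MaslovPotential} (C : MCS L μ) {m i j k l : ℕ}
  {q : Fin L.word.length}

theorem coeff_crossing (h : C.tangles[m]? = some (.sing q)) (hk : L.word.get q = .crossing k)
    (hi : i < C.strands (m + 1)) (hj : j < C.strands (m + 1)) :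
    coeff (C.d (m + 1)) i j =
      coeff (C.d m) (Equiv.swap k (k + 1) i) (Equiv.swap k (k + 1) j) := by
  have hs : C.strands (m + 1) = C.strands m := C.strands_succ h hk
  have hf : k + 1 < C.strands m := C.fits h hk
  rw [← coeff_eq_of_indexMap (Equiv.swap k (k + 1)).injective (C.crossing m q k h hk).2
    ((swap_succ_lt hf).2 (hs ▸ hi)) ((swap_succ_lt hf).2 (hs ▸ hj))
    (by rwa [Equiv.swap_apply_self]), Equiv.swap_apply_self, Equiv.swap_apply_self]

theorem coeff_handleslide (h : C.tangles[m]? = some (.handleslide k l))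
    (hij : i < j) (hj : j < C.strands (m + 1)) :
    coeff (C.d (m + 1)) i j = slideStep k l (coeff (C.d m)) i j := by
  obtain ⟨hkl, hl, -⟩ := C.handleslide_mark m k l h
  have hs := C.strands_handleslide h
  have hj' : j < C.strands m := hs ▸ hj
  have row_l : coeff (C.d m) l j = coeff (C.d (m + 1)) l j := by
    have := Legendrian.coeff_handleslide (C.handleslide m k l h) hs (hkl.trans hl) hl hj'
    rwa [if_neg hkl.ne', add_zero, C.coeff_eq_zero_of_le hkl.le, ite_self, add_zero] at this
  have row_i := Legendrian.coeff_handleslide (C.handleslide m k l h) hs (hkl.trans hl)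
    (hij.trans hj') hj'
  have slide_top : (if i = k ∧ l < j then coeff (C.d m) l j else 0) =
      if i = k then coeff (C.d m) l j else 0 := by
    rw [ite_and]
    exact ite_congr rfl (fun _ => ite_eq_left_iff.2 fun hlj =>
      (C.coeff_eq_zero_of_le (not_lt.1 hlj)).symm) fun _ => rfl
  have slide_bot : (if j = l ∧ i < k then coeff (C.d m) i k else 0) =
      if j = l then coeff (C.d m) i k else 0 := by
    rw [ite_and]
    exact ite_congr rfl (fun _ => ite_eq_left_iff.2 fun hik =>
      (C.coeff_eq_zero_of_le (not_lt.1 hik)).symm) fun _ => rfl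
  rw [slideStep, slide_top, slide_bot, add_right_comm, row_i, row_l, add_assoc,
    CharTwo.add_self_eq_zero, add_zero]

theorem coeff_rightCusp (h : C.tangles[m]? = some (.sing q)) (hk : L.word.get q = .rightCusp k)
    (hi : i < C.strands (m + 1)) (hj : j < C.strands (m + 1)) :
    coeff (C.d (m + 1)) i j = coeff (C.d m) (shift k i) (shift k j) +
      coeff (C.d m) (shift k i) (k + 1) * coeff (C.d m) k (shift k j) := by
  have hs : C.strands (m + 1) = C.strands m - 2 := C.strands_succ h hk
  have hf : k + 1 < C.strands m := C.fits h hk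
  obtain ⟨h_one, h_iso⟩ := C.rightCusp m q k h hk
  exact coeff_cusp h_iso (C.coeff_eq_zero_of_le le_rfl) h_one (by omega) (by omega) hi hj

theorem coeff_rightCusp_of_even (h : C.tangles[m]? = some (.sing q))
    (hk : L.word.get q = .rightCusp k) (hke : Even k) (hi : Even i)
    (hj : i + 1 < C.strands (m + 1)) :
    coeff (C.d (m + 1)) i (i + 1) = coeff (C.d m) (shift k i) (shift k (i + 1)) := by
  have product_eq_zero :
      coeff (C.d m) (shift k i) (k + 1) * coeff (C.d m) k (shift k (i + 1)) = 0 := by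
    rw [Nat.even_iff] at hke hi
    rcases lt_or_ge i k with hik | hik
    · rw [shift_of_lt (i := i + 1) (by omega), C.coeff_eq_zero_of_le (i := k) (by omega), mul_zero]
    · rw [shift_of_le hik, C.coeff_eq_zero_of_le (by omega), zero_mul]
  rw [C.coeff_rightCusp h hk (Nat.lt_of_succ_lt hj) hj, product_eq_zero, add_zero]

/-- A coefficient of a differential, as an element of the algebra. -/
noncomputable def coeffAlg (m i j : ℕ) : L.Alg := algebraMap (ZMod 2) L.Alg (coeff (C.d m) i j)

/-- The sum of the words of the left parts of chord paths which start with the chord `[i, j]`, plus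
the coefficient of the differential. This is the counterpart of `Front.diskSum`: the coefficient
accounts for the disks without further convex corners. -/
noncomputable def fullSum (m i j : ℕ) : L.Alg := C.chordSum m i j + C.coeffAlg m i j

theorem chordSystem_terminal_iff (h : C.tangles[m]? = some (.sing q))
    (hk : L.word.get q = .crossing k) : C.chordSystem.terminal ⟨m + 1, i, j⟩ ↔
      (j = k ∧ coeff (C.d m) i k = 1) ∨ (i = k + 1 ∧ coeff (C.d m) (k + 1) j = 1) := by
  simp only [chordSystem, C.terminatesAt_iff h, hk, Singularity.crossing.injEq, exists_eq_left',
    exists_and_right, and_iff_right_iff_imp]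
  exact fun _ => ⟨Front.crossingGen q hk, rfl⟩

theorem not_terminal_of_ne_crossing (h : C.tangles[m]? = some (.sing q))
    (hne : ∀ k, L.word.get q ≠ .crossing k) : ¬ C.chordSystem.terminal ⟨m + 1, i, j⟩ := by
  rintro ⟨b, hb⟩
  obtain ⟨-, k, hk, -⟩ := (C.terminatesAt_iff h).1 hb
  exact hne k hk

theorem not_terminal_of_handleslide (h : C.tangles[m]? = some (.handleslide k l)) :
    ¬ C.chordSystem.terminal ⟨m + 1, i, j⟩ := by
  rintro ⟨b, p, _, hp, -, hpos, -⟩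
  obtain rfl : m = p := Nat.succ_injective hpos
  exact absurd (h.symm.trans hp) (by simp)

open Classical in
theorem terminal_monomial_crossing (h : C.tangles[m]? = some (.sing q))
    (hk : L.word.get q = .crossing k) (hij : i < j) :
    (if C.chordSystem.terminal ⟨m + 1, i, j⟩ then
        Front.monomial (C.chordSystem.final ⟨m + 1, i, j⟩) else 0) =
      (if i = k + 1 then FreeAlgebra.ι (ZMod 2) (Front.crossingGen q hk) * C.coeffAlg m (k + 1) j
        else 0) +
      (if j = k then C.coeffAlg m i k * FreeAlgebra.ι (ZMod 2) (Front.crossingGen q hk)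
        else 0) := by
  have final_eq (ht : C.chordSystem.terminal ⟨m + 1, i, j⟩) :
      Front.monomial (C.chordSystem.final ⟨m + 1, i, j⟩) =
        FreeAlgebra.ι (ZMod 2) (Front.crossingGen q hk) := by
    rw [C.chordSystem_final (b := Front.crossingGen q hk) ((C.terminatesAt_iff h).2
      ⟨rfl, k, hk, (C.chordSystem_terminal_iff h hk).1 ht⟩), Front.monomial_singleton]
  rw [ite_congr rfl final_eq fun _ => rfl]
  simp only [C.chordSystem_terminal_iff h hk, coeffAlg, ← Algebra.commutes, ← Algebra.smul_def,
    ← ite_eq_one_eq_smul]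
  by_cases hi : i = k + 1
  · simp [hi, show j ≠ k by omega]
  · simp only [hi, false_and, or_false, if_false, zero_add, ite_and]

theorem chordSum_crossing (h : C.tangles[m]? = some (.sing q)) (hk : L.word.get q = .crossing k)
    (hij : i < j) (hj : j < C.strands (m + 1)) :
    C.chordSum (m + 1) i j =
      (if i = k + 1 then FreeAlgebra.ι (ZMod 2) (Front.crossingGen q hk) * C.coeffAlg m (k + 1) j
        else 0) +
      (if j = k then C.coeffAlg m i k * FreeAlgebra.ι (ZMod 2) (Front.crossingGen q hk) else 0) +
      crossStep k (FreeAlgebra.ι (ZMod 2) (Front.crossingGen q hk)) (C.chordSum m) i j := by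
  rw [chordSum, ChordSystem.pathSum_crossing (C.slab_eq h) hk ⟨hij, hj⟩
    fun a b => (C.chordStep_crossing h hk).trans mem_crossingSuccessors.symm,
    C.terminal_monomial_crossing h hk hij]
  rfl

theorem fullSum_crossing (h : C.tangles[m]? = some (.sing q)) (hk : L.word.get q = .crossing k)
    (hij : i < j) (hj : j < C.strands (m + 1)) :
    C.fullSum (m + 1) i j =
      crossStep k (FreeAlgebra.ι (ZMod 2) (Front.crossingGen q hk)) (C.fullSum m) i j := by
  have coeffAlg_succ : C.coeffAlg (m + 1) i j = if i = k ∧ j = k + 1 then 0 else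
      C.coeffAlg m (Equiv.swap k (k + 1) i) (Equiv.swap k (k + 1) j) := by
    rw [coeffAlg, C.coeff_crossing h hk (hij.trans hj) hj]
    split_ifs with hkk
    · rw [hkk.1, hkk.2, Equiv.swap_apply_left, Equiv.swap_apply_right,
        C.coeff_eq_zero_of_le k.le_succ, map_zero]
    · rfl
  unfold fullSum
  rw [crossStep_add, C.chordSum_crossing h hk hij hj, coeffAlg_succ]
  simp only [crossStep]
  abel

theorem chordSum_handleslide (h : C.tangles[m]? = some (.handleslide k l))
    (hij : i < j) (hj : j < C.strands (m + 1)) :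
    C.chordSum (m + 1) i j = slideStep k l (C.chordSum m) i j := by
  have hkl := (C.handleslide_mark m k l h).1
  rw [chordSum, ChordSystem.pathSum_of_not_crossing (C.ne_crossing_of_slab_handleslide h) ⟨hij, hj⟩
    ({(i, j)} ∪ (if i = k ∧ l < j then {(l, j)} else ∅) ∪ if j = l ∧ i < k then {(i, k)} else ∅),
    if_neg (C.not_terminal_of_handleslide h), zero_add, Finset.sum_union, Finset.sum_union,
    Finset.sum_singleton, slideStep]
  · congr 2
    all_goals split_ifs <;> simp [chordSum]
  · split_ifs <;> simp; omega
  · split_ifs <;> simp <;> omega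
  · intro a b
    refine (C.chordStep_handleslide h).trans ?_
    simp only [Finset.mem_union, Finset.mem_singleton, Prod.mk.injEq, or_assoc]
    refine or_congr_right (or_congr ?_ ?_) <;> split_ifs with hs <;> simp <;> tauto

theorem fullSum_handleslide (h : C.tangles[m]? = some (.handleslide k l))
    (hij : i < j) (hj : j < C.strands (m + 1)) :
    C.fullSum (m + 1) i j = slideStep k l (C.fullSum m) i j := by
  unfold fullSum
  rw [slideStep_add, C.chordSum_handleslide h hij hj, coeffAlg, C.coeff_handleslide h hij hj,
    map_slideStep]
  rfl

open Classical in
theorem chordSum_of_ne_crossing (h : C.tangles[m]? = some (.sing q))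
    (hne : ∀ k, L.word.get q ≠ .crossing k) (hij : i < j) (hj : j < C.strands (m + 1))
    (s : Finset (ℕ × ℕ)) (hs : ∀ a b, C.ChordStep ⟨m + 1, i, j⟩ ⟨m, a, b⟩ ↔ (a, b) ∈ s) :
    C.chordSum (m + 1) i j = ∑ p ∈ s, C.chordSum m p.1 p.2 := by
  rw [chordSum, ChordSystem.pathSum_of_not_crossing (C.ne_crossing_of_slab h hne) ⟨hij, hj⟩ s hs,
    if_neg (C.not_terminal_of_ne_crossing h hne), zero_add]
  rfl

theorem chordSum_leftCusp (h : C.tangles[m]? = some (.sing q)) (hk : L.word.get q = .leftCusp k)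
    (hij : i < j) (hj : j < C.strands (m + 1)) : C.chordSum (m + 1) i j = 0 := by
  rw [C.chordSum_of_ne_crossing h (fun l => by rw [hk]; nofun) hij hj ∅, Finset.sum_empty]
  simp [C.not_chordStep_leftCusp h hk]

theorem chordSum_rightCusp (h : C.tangles[m]? = some (.sing q)) (hk : L.word.get q = .rightCusp k)
    (hij : i < j) (hj : j < C.strands (m + 1)) :
    C.chordSum (m + 1) i j = C.chordSum m (shift k i) (shift k j) := by
  rw [C.chordSum_of_ne_crossing h (fun l => by rw [hk]; nofun) hij hj {(shift k i, shift k j)},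
    Finset.sum_singleton]
  simp [C.chordStep_rightCusp h hk]

theorem fullSum_rightCusp (h : C.tangles[m]? = some (.sing q)) (hk : L.word.get q = .rightCusp k)
    (hke : Even k) (hi : Even i) (hj : i + 1 < C.strands (m + 1)) :
    C.fullSum (m + 1) i (i + 1) = C.fullSum m (shift k i) (shift k (i + 1)) := by
  simp only [fullSum, C.chordSum_rightCusp h hk i.lt_succ_self hj, coeffAlg,
    C.coeff_rightCusp_of_even h hk hke hi hj]

end MCS

/-! ### Differentials in `A`-form -/

section Leibniz

variable {Q : Type} {D : FreeAlgebra (ZMod 2) Q →ₗ[ZMod 2] FreeAlgebra (ZMod 2) Q}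
  {f : Q → FreeAlgebra (ZMod 2) Q}

theorem map_algebraMap_of_leibniz (hD : ∀ x y, D (x * y) = x * D y + D x * y) (r : ZMod 2) :
    D (algebraMap (ZMod 2) _ r) = 0 := by
  have map_one_eq_zero : D 1 = 0 := by simpa using hD 1 1
  rw [Algebra.algebraMap_eq_smul_one, map_smul, map_one_eq_zero, smul_zero]

theorem eq_leibnizExt (hD : ∀ x y, D (x * y) = x * D y + D x * y)
    (hf : ∀ q, D (FreeAlgebra.ι (ZMod 2) q) = f q) : D = leibnizExt f := by
  ext x
  induction x using FreeAlgebra.induction with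
  | grade0 r =>
    rw [map_algebraMap_of_leibniz hD, map_algebraMap_of_leibniz (leibnizExt_mul f)]
  | grade1 q => rw [hf, leibnizExt_ι]
  | mul x y hx hy => rw [hD, leibnizExt_mul, hx, hy]
  | add x y hx hy => rw [map_add, map_add, hx, hy]

theorem map_leibnizExt_eq_zero {B : Type*} [Semiring B] [Algebra (ZMod 2) B]
    (ε : FreeAlgebra (ZMod 2) Q →ₐ[ZMod 2] B) (hf : ∀ q, ε (f q) = 0)
    (x : FreeAlgebra (ZMod 2) Q) : ε (leibnizExt f x) = 0 := by
  induction x using FreeAlgebra.induction with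
  | grade0 r => rw [map_algebraMap_of_leibniz (leibnizExt_mul f), map_zero]
  | grade1 q => rw [leibnizExt_ι, hf]
  | mul x y hx hy => rw [leibnizExt_mul, map_add, map_mul, map_mul, hx, hy, mul_zero, zero_mul,
      add_zero]
  | add x y hx hy => rw [map_add, map_add, hx, hy, add_zero]

end Leibniz

/-- The place of a kind of singularity in a front in which all left cusps precede all crossings,
and these precede all right cusps. -/
def Singularity.rank : Singularity → ℕ
  | .leftCusp _ => 0
  | .crossing _ => 1
  | .rightCusp _ => 2

namespace Front

variable {L : Front} {t t' : Singularity} {g g' k : ℕ}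

/-- A front whose left cusps come first, then the crossings, and then the right cusps, where the
right cusps are not nested but the left cusps may be. As for `IsNearlyPlat`, not being nested means
that the upper strand at each right cusp has an even number. -/
def IsRightPlat (L : Front) : Prop :=
  ∃ l c r : List ℕ, L.word = l.map .leftCusp ++ c.map .crossing ++ r.map .rightCusp ∧
    ∀ k ∈ r, Even k

theorem IsNearlyPlat.isRightPlat (hL : L.IsNearlyPlat) : L.IsRightPlat := by
  obtain ⟨l, c, r, hw, -, hr⟩ := hL
  exact ⟨l, c, r, hw, hr⟩

theorem IsRightPlat.rank_le (hL : L.IsRightPlat) (hg : g ≤ g') (h : L.word[g]? = some t)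
    (h' : L.word[g']? = some t') : t.rank ≤ t'.rank := by
  obtain ⟨l, c, r, hw, -⟩ := hL
  have rank_pairwise : L.word.Pairwise fun t t' => t.rank ≤ t'.rank := by
    simp only [hw, List.pairwise_append, List.pairwise_map, List.mem_append, List.mem_map,
      Singularity.rank]
    refine ⟨⟨List.pairwise_of_forall fun _ _ => le_rfl,
      List.pairwise_of_forall fun _ _ => le_rfl, ?_⟩,
      List.pairwise_of_forall fun _ _ => le_rfl, ?_⟩
    · rintro _ ⟨a, -, rfl⟩ _ ⟨b, -, rfl⟩
      exact Nat.zero_le 1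
    · rintro _ (⟨a, -, rfl⟩ | ⟨a, -, rfl⟩) _ ⟨b, -, rfl⟩
      exacts [Nat.zero_le 2, Nat.le_succ 1]
  obtain ⟨hlt, rfl⟩ := List.getElem?_eq_some_iff.1 h
  obtain ⟨hlt', rfl⟩ := List.getElem?_eq_some_iff.1 h'
  rcases hg.eq_or_lt with rfl | hg
  · exact le_rfl
  · exact List.pairwise_iff_getElem.1 rank_pairwise g g' hlt hlt' hg

theorem IsRightPlat.ne_rightCusp_of_le (hL : L.IsRightPlat) (hg : g ≤ g')
    (h' : L.word[g']? = some t') (ht' : ∀ k, t' ≠ .rightCusp k) (k : ℕ) :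
    L.word[g]? ≠ some (.rightCusp k) := by
  intro h
  have rank_le := hL.rank_le hg h h'
  cases t' with
  | rightCusp l => exact ht' l rfl
  | _ => simp [Singularity.rank] at rank_le

theorem IsRightPlat.even_of_rightCusp (hL : L.IsRightPlat) (h : L.word[g]? = some (.rightCusp k)) :
    Even k := by
  obtain ⟨l, c, r, hw, hr⟩ := hL
  have mem_word := List.mem_of_getElem? h
  simp only [hw, List.mem_append, List.mem_map, reduceCtorEq, and_false, exists_false,
    Singularity.rightCusp.injEq, exists_eq_right, false_or] at mem_word
  exact hr k mem_word

theorem phiHom_ι (ε : L.Alg →ₐ[ZMod 2] ZMod 2) (q : L.Generator) :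
    phiHom ε (FreeAlgebra.ι (ZMod 2) q) =
      FreeAlgebra.ι (ZMod 2) q + algebraMap (ZMod 2) L.Alg (ε (FreeAlgebra.ι (ZMod 2) q)) :=
  FreeAlgebra.lift_ι_apply _ _

theorem phiHom_phiHom (ε : L.Alg →ₐ[ZMod 2] ZMod 2) (x : L.Alg) : phiHom ε (phiHom ε x) = x :=
  DFunLike.congr_fun (phiHom_comp_self ε) x

theorem algebraMapInv_phiHom (ε : L.Alg →ₐ[ZMod 2] ZMod 2) (x : L.Alg) :
    FreeAlgebra.algebraMapInv (phiHom ε x) = ε x := by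
  have comp_eq : FreeAlgebra.algebraMapInv.comp (phiHom ε) = ε := by
    ext q
    simp [phiHom_ι, FreeAlgebra.algebraMapInv]
  exact DFunLike.congr_fun comp_eq x

theorem algebraMapInv_monomial {w : List L.Generator} (hw : 1 ≤ w.length) :
    FreeAlgebra.algebraMapInv (monomial w) = 0 := by
  cases w with
  | nil => simp at hw
  | cons q w => simp [monomial, FreeAlgebra.algebraMapInv]

theorem augDiff_eq_leibnizExt (ε : L.Alg →ₐ[ZMod 2] ZMod 2) :
    L.augDiff ε = leibnizExt fun q => phiHom ε (L.ceGen q) := by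
  have augDiff_apply (x : L.Alg) : L.augDiff ε x = phiHom ε (L.ceDiff (phiHom ε x)) := rfl
  have ceDiff_mul (x y : L.Alg) : L.ceDiff (x * y) = x * L.ceDiff y + L.ceDiff x * y :=
    leibnizExt_mul _ x y
  refine eq_leibnizExt (fun x y => ?_) fun q => ?_
  · simp only [augDiff_apply, map_mul (phiHom ε), ceDiff_mul, map_add, phiHom_phiHom]
  · rw [augDiff_apply, phiHom_ι, map_add, map_algebraMap_of_leibniz ceDiff_mul, add_zero, ceDiff,
      leibnizExt_ι]

end Front

namespace MCS

variable {L : Front} {μ : L.MaslovPotential} (C : MCS L μ) {m i j k l : ℕ}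
  {q : Fin L.word.length}

/-- The vertical line number `m` is not immediately to the right of a handleslide mark. Only over
such lines can `MCS.fullSum` be compared with `Front.diskSum`. -/
def Settled (m : ℕ) : Prop := ∀ n k l, n + 1 = m → C.tangles[n]? ≠ some (.handleslide k l)

/-- Over the vertical line number `m`, the sums over chord paths together with the coefficients of
the differential are the sums over disks, written in the generators `φ^ε q`. -/
def SumsAgree (m : ℕ) : Prop :=
  ∀ i j, i < j → j < C.strands m →
    C.fullSum m i j = Front.phiHom C.augmentation (L.diskSum (C.gap m) i j)

open Classical in
theorem augmentation_ι (q : L.Generator) :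
    C.augmentation (FreeAlgebra.ι (ZMod 2) q) = if C.IsMarked q then 1 else 0 :=
  FreeAlgebra.lift_ι_apply _ _

theorem algebraMapInv_diffGen (a : L.Generator) :
    FreeAlgebra.algebraMapInv (C.diffGen a) = 0 := by
  have zero_add_zero (x y : L.Alg) (hx : FreeAlgebra.algebraMapInv x = 0)
      (hy : FreeAlgebra.algebraMapInv y = 0) : FreeAlgebra.algebraMapInv (x + y) = 0 := by
    rw [map_add, hx, hy, add_zero]
  refine finsum_induction (FreeAlgebra.algebraMapInv · = 0) (map_zero _) zero_add_zero fun w => ?_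
  refine finsum_induction (FreeAlgebra.algebraMapInv · = 0) (map_zero _) zero_add_zero fun hw => ?_
  rw [map_smul, Front.algebraMapInv_monomial hw.1, smul_zero]

variable {C}

theorem IsSimple.coeff_leftCusp_top (hC : C.IsSimple) (h : C.tangles[m]? = some (.sing q))
    (hk : L.word.get q = .leftCusp k) (hj : j ≠ k + 1) : coeff (C.d (m + 1)) k j = 0 := by
  rcases le_or_gt j k with hjk | hjk
  · exact C.coeff_eq_zero_of_le hjk
  · exact (hC m q k h hk).2 j (by omega)

theorem IsSimple.coeff_leftCusp_bot (hC : C.IsSimple) (h : C.tangles[m]? = some (.sing q))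
    (hk : L.word.get q = .leftCusp k) (hi : i ≠ k) : coeff (C.d (m + 1)) i (k + 1) = 0 := by
  rcases lt_or_ge i k with hik | hik
  · exact (hC m q k h hk).1 i hik
  · exact C.coeff_eq_zero_of_le (by omega)

theorem IsSimple.coeff_leftCusp_shift (hC : C.IsSimple) (h : C.tangles[m]? = some (.sing q))
    (hk : L.word.get q = .leftCusp k) (hi : i < C.strands m) (hj : j < C.strands m) :
    coeff (C.d (m + 1)) (shift k i) (shift k j) = coeff (C.d m) i j := by
  obtain ⟨h_one, h_iso⟩ := C.leftCusp m q k h hk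
  rw [coeff_cusp h_iso (C.coeff_eq_zero_of_le le_rfl) h_one (C.strands_succ h hk) (C.fits h hk)
    hi hj, hC.coeff_leftCusp_top h hk (shift_ne_succ k j), mul_zero, add_zero]

theorem IsSimple.coeff_leftCusp_of_eq (hC : C.IsSimple) (h : C.tangles[m]? = some (.sing q))
    (hk : L.word.get q = .leftCusp k) (hne : i ≠ k ∨ j ≠ k + 1)
    (heq : i = k ∨ i = k + 1 ∨ j = k ∨ j = k + 1) : coeff (C.d (m + 1)) i j = 0 := by
  have h_one := (C.leftCusp m q k h hk).1
  rcases heq with rfl | rfl | rfl | rfl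
  · exact hC.coeff_leftCusp_top h hk (hne.resolve_left (not_not.2 rfl))
  · exact coeff_eq_zero_of_row_eq_single (C.d_comp_d _) h_one
      (fun _ => hC.coeff_leftCusp_top h hk) j
  · exact coeff_eq_zero_of_column_eq_single (C.d_comp_d _) h_one
      (fun _ => hC.coeff_leftCusp_bot h hk) i
  · exact hC.coeff_leftCusp_bot h hk (hne.resolve_right (not_not.2 rfl))

theorem Settled.not_isMarked {q : L.Generator} (hm : C.Settled m)
    (h : C.tangles[m]? = some (.sing q.1)) : ¬ C.IsMarked q := by
  rintro ⟨-, n, k, l, h_slide, h_sing⟩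
  exact hm n k l (C.tangle_unique h_sing h) h_slide

namespace IsAForm

theorem settled (hC : C.IsAForm) (h : C.tangles[m]? = some (.sing q))
    (hne : ∀ k, L.word.get q ≠ .crossing k) : C.Settled m := by
  rintro n k l rfl h_slide
  obtain ⟨-, q', h', hk⟩ := hC.2 n k l h_slide
  obtain rfl : q = q' := Tangle.sing.inj (Option.some.inj (h.symm.trans h'))
  exact hne k hk

theorem settled_of_handleslide (hC : C.IsAForm) (h : C.tangles[m]? = some (.handleslide k l)) :
    C.Settled m := by
  rintro n k' l' rfl h_slide
  obtain ⟨-, q', h', -⟩ := hC.2 n k' l' h_slide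
  exact absurd (h.symm.trans h') (by simp)

theorem handleslide_eq (hC : C.IsAForm) (h : C.tangles[m + 1]? = some (.sing q))
    (hk : L.word.get q = .crossing k) {k' : ℕ} (h' : C.tangles[m]? = some (.handleslide k' l)) :
    C.tangles[m]? = some (.handleslide k (k + 1)) := by
  obtain ⟨rfl, q', h_sing, hk'⟩ := hC.2 m k' l h'
  obtain rfl : q = q' := Tangle.sing.inj (Option.some.inj (h.symm.trans h_sing))
  obtain rfl : k = k' := Singularity.crossing.inj (hk.symm.trans hk')
  exact h'

theorem chordSum_eq_zero_of_leftCusp (hC : C.IsAForm) (hL : L.IsRightPlat)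
    (h : C.tangles[m]? = some (.sing q)) (hk : L.word.get q = .leftCusp k) (hij : i < j)
    (hj : j < C.strands m) : C.chordSum m i j = 0 := by
  cases m with
  | zero => exact absurd hj (Nat.not_lt_zero _)
  | succ n =>
    obtain ⟨t, ht⟩ := C.exists_tangle_of_succ h
    cases t with
    | handleslide k' l' =>
      exact absurd ht (hC.settled h (fun l => by rw [hk]; nofun) n k' l' rfl)
    | sing q' =>
      have gap_lt : (q' : ℕ) < q := by
        rw [← C.gap_eq h, C.gap_succ_eq ht]
        exact Nat.lt_succ_self _
      have rank_le := hL.rank_le gap_lt.le (Front.getElem?_of_get rfl) (Front.getElem?_of_get hk)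
      rcases hk' : L.word.get q' with k' | k' | k'
      · exact C.chordSum_leftCusp ht hk' hij hj
      all_goals exact absurd (hk' ▸ rank_le) (by simp [Singularity.rank])

theorem sumsAgree_leftCusp (hC : C.IsAForm) (hL : L.IsRightPlat)
    (h : C.tangles[m]? = some (.sing q)) (hk : L.word.get q = .leftCusp k)
    (ih : C.SumsAgree m) : C.SumsAgree (m + 1) := by
  intro i j hij hj
  have hq := Front.getElem?_of_get hk
  have hj_disk : j < L.strands (q + 1) := by rwa [MarkedFront.strands, C.gap_succ_eq h] at hj
  have hs : C.strands (m + 1) = C.strands m + 2 := C.strands_succ h hk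
  rw [fullSum, C.chordSum_leftCusp h hk hij hj, zero_add, coeffAlg, C.gap_succ_eq h]
  by_cases h_cusp : i = k ∧ j = k + 1
  · obtain ⟨rfl, rfl⟩ := h_cusp
    rw [(C.leftCusp m q i h hk).1, Front.diskSum_leftCusp_self hq, map_one, map_one]
  by_cases h_end : i = k ∨ i = k + 1 ∨ j = k ∨ j = k + 1
  · have hne := not_and_or.1 h_cusp
    rw [hC.1.coeff_leftCusp_of_eq h hk hne h_end,
      Front.diskSum_leftCusp_of_eq hq hij hj_disk hne h_end, map_zero, map_zero]
  · simp only [not_or] at h_end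
    obtain ⟨i, rfl⟩ := exists_shift_eq h_end.1 h_end.2.1
    obtain ⟨j, rfl⟩ := exists_shift_eq h_end.2.2.1 h_end.2.2.2
    rw [shift_lt_shift] at hij
    rw [hs, shift_lt_add_two (C.fits h hk)] at hj
    have sums_eq := ih i j hij hj
    rw [fullSum, hC.chordSum_eq_zero_of_leftCusp hL h hk hij hj, zero_add, coeffAlg,
      C.gap_eq h] at sums_eq
    rw [hC.1.coeff_leftCusp_shift h hk (hij.trans hj) hj, sums_eq,
      Front.diskSum_leftCusp_shift hq hij (by rwa [MarkedFront.strands, C.gap_eq h] at hj)]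

/-- Together with its handleslide mark, if there is one, the crossing `q` acts on the sums like a
crossing with generator `φ^ε q`. -/
theorem exists_settled_crossing (hC : C.IsAForm) (h : C.tangles[m]? = some (.sing q))
    (hk : L.word.get q = .crossing k) :
    ∃ n ≤ m, C.Settled n ∧ C.gap n = q ∧ C.fullSum m k (k + 1) = C.fullSum n k (k + 1) ∧
      ∀ i j, i < j → j < C.strands (m + 1) → C.fullSum (m + 1) i j =
        crossStep k (Front.phiHom C.augmentation (FreeAlgebra.ι (ZMod 2) (Front.crossingGen q hk)))
          (C.fullSum n) i j := by
  have hs : C.strands (m + 1) = C.strands m := C.strands_succ h hk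
  have hf : k + 1 < C.strands m := C.fits h hk
  by_cases hm : C.Settled m
  · refine ⟨m, le_rfl, hm, C.gap_eq h, rfl, fun i j hij hj => ?_⟩
    have not_isMarked : ¬ C.IsMarked (Front.crossingGen q hk) := hm.not_isMarked h
    rw [C.fullSum_crossing h hk hij hj, Front.phiHom_ι, C.augmentation_ι, if_neg not_isMarked,
      map_zero, add_zero]
  · simp only [Settled, not_forall, not_not] at hm
    obtain ⟨n, k', l, rfl, h_slide⟩ := hm
    have h_slide := hC.handleslide_eq h hk h_slide
    have isMarked : C.IsMarked (Front.crossingGen q hk) := ⟨⟨k, hk⟩, n, k, k + 1, h_slide, h⟩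
    refine ⟨n, n.le_succ, hC.settled_of_handleslide h_slide,
      (C.gap_succ_handleslide h_slide).symm.trans (C.gap_eq h), ?_, fun i j hij hj => ?_⟩
    · rw [C.fullSum_handleslide h_slide k.lt_succ_self hf, slideStep_self_succ]
    · rw [C.fullSum_crossing h hk hij hj, Front.phiHom_ι, C.augmentation_ι, if_pos isMarked,
        map_one, ← crossStep_slideStep k _ _ hij]
      exact crossStep_congr _ hf (fun _ _ => C.fullSum_handleslide h_slide) hij (hs ▸ hj)

theorem sumsAgree_crossing (hC : C.IsAForm) (h : C.tangles[m]? = some (.sing q))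
    (hk : L.word.get q = .crossing k) (ih : ∀ n ≤ m, C.Settled n → C.SumsAgree n) :
    C.SumsAgree (m + 1) := by
  intro i j hij hj
  obtain ⟨n, hnm, hn, hgap, -, h_step⟩ := hC.exists_settled_crossing h hk
  have hs : C.strands (m + 1) = C.strands m := C.strands_succ h hk
  have hs' : C.strands n = C.strands m := by
    rw [MarkedFront.strands, MarkedFront.strands, hgap, C.gap_eq h]
  rw [h_step i j hij hj, C.gap_succ_eq h, Front.diskSum_crossing hk hij
    (by rwa [MarkedFront.strands, C.gap_succ_eq h] at hj), ← RingHom.coe_coe, map_crossStep]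
  refine crossStep_congr _ (C.fits h hk) (fun a b hab hb => ?_) hij (hs ▸ hj)
  rw [ih n hnm hn a b hab (hs' ▸ hb), hgap]
  rfl

theorem sumsAgree (hC : C.IsAForm) (hL : L.IsRightPlat) (hm : C.Settled m)
    (hr : ∀ g k, g < C.gap m → L.word[g]? ≠ some (.rightCusp k)) : C.SumsAgree m := by
  induction m using Nat.strong_induction_on with
  | _ m ih =>
  have ih_of_lt {n : ℕ} (hn : n < m) (hn' : C.Settled n) : C.SumsAgree n :=
    ih n hn hn' fun g k hg => hr g k (hg.trans_le (C.gap_mono hn.le))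
  cases m with
  | zero => exact fun _ _ _ hj => absurd hj (Nat.not_lt_zero _)
  | succ m =>
    rcases ht : C.tangles[m]? with _ | ⟨q⟩ | ⟨k, l⟩
    · intro i j _ hj
      rw [C.strands_of_length_le (Nat.le_succ_of_le (List.getElem?_eq_none_iff.1 ht))] at hj
      exact absurd hj (Nat.not_lt_zero _)
    · rcases hk : L.word.get q with k | k | k
      · exact hC.sumsAgree_leftCusp hL ht hk
          (ih_of_lt m.lt_succ_self (hC.settled ht fun l => by rw [hk]; nofun))
      · exact hC.sumsAgree_crossing ht hk fun n hn => ih_of_lt (Nat.lt_succ_of_le hn)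
      · refine absurd (Front.getElem?_of_get hk) (hr q k ?_)
        rw [C.gap_succ_eq ht]
        exact Nat.lt_succ_self _
    · exact absurd ht (hm m k l rfl)

theorem fullSum_pair_eq (hC : C.IsAForm) (hL : L.IsRightPlat) (hm : C.Settled m)
    (hi : Even i) (hj : i + 1 < C.strands m) :
    C.fullSum m i (i + 1) = Front.phiHom C.augmentation (L.diskSum (C.gap m) i (i + 1)) := by
  induction m generalizing i with
  | zero => exact absurd hj (Nat.not_lt_zero _)
  | succ m ih =>
    rcases ht : C.tangles[m]? with _ | ⟨q⟩ | ⟨k, l⟩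
    · rw [C.strands_of_length_le (Nat.le_succ_of_le (List.getElem?_eq_none_iff.1 ht))] at hj
      exact absurd hj (Nat.not_lt_zero _)
    · by_cases h_right : ∃ k, L.word.get q = .rightCusp k
      · obtain ⟨k, hk⟩ := h_right
        have hq := Front.getElem?_of_get hk
        have hke := hL.even_of_rightCusp hq
        have hs : C.strands (m + 1) = C.strands m - 2 := C.strands_succ ht hk
        have hf : k + 1 < C.strands m := C.fits ht hk
        have hj' : shift k i + 1 < C.strands m := by
          rw [← shift_succ_of_even hke hi, show C.strands m = C.strands (m + 1) + 2 by omega,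
            shift_lt_add_two (by omega)]
          exact hj
        rw [C.fullSum_rightCusp ht hk hke hi hj, C.gap_succ_eq ht, Front.diskSum_rightCusp hq
          i.lt_succ_self (by rwa [MarkedFront.strands, C.gap_succ_eq ht] at hj),
          shift_succ_of_even hke hi, ← C.gap_eq ht]
        exact ih (hC.settled ht fun l => by rw [hk]; nofun) (even_shift hi) hj'
      · refine hC.sumsAgree hL hm (fun g k hg => ?_) _ _ i.lt_succ_self hj
        rw [C.gap_succ_eq ht] at hg
        exact hL.ne_rightCusp_of_le (Nat.le_of_lt_succ hg) (Front.getElem?_of_get rfl)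
          (not_exists.1 h_right) k
    · exact absurd ht (hm m k l rfl)

theorem diffGen_eq_phiHom_of_crossing (hC : C.IsAForm) (hL : L.IsRightPlat) {a : L.Generator}
    (hk : L.word.get a.1 = .crossing k) :
    C.diffGen a = Front.phiHom C.augmentation (L.ceGen a) := by
  obtain ⟨m, hm⟩ := C.exists_tangle a.1
  obtain ⟨n, -, hn, hgap, h_pair, -⟩ := hC.exists_settled_crossing hm hk
  have no_rightCusp (g l : ℕ) (hg : g < C.gap n) : L.word[g]? ≠ some (.rightCusp l) :=
    hL.ne_rightCusp_of_le (hgap ▸ hg.le) (Front.getElem?_of_get hk) (by simp) l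
  have hf : k + 1 < C.strands n := by
    rw [MarkedFront.strands, hgap, ← C.gap_eq hm]
    exact C.fits hm hk
  calc C.diffGen a = C.chordSum m k (k + 1) := C.diffGen_eq hm (Or.inl hk)
    _ = C.fullSum m k (k + 1) := by
      rw [fullSum, coeffAlg, (C.crossing m a.1 k hm hk).1, map_zero, add_zero]
    _ = C.fullSum n k (k + 1) := h_pair
    _ = Front.phiHom C.augmentation (L.diskSum a.1 k (k + 1)) := by
      rw [hC.sumsAgree hL hn no_rightCusp k (k + 1) k.lt_succ_self hf, hgap]
    _ = Front.phiHom C.augmentation (L.ceGen a) := by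
      rw [Front.ceGen_eq (Or.inl hk), if_neg (by rw [hk]; simp), zero_add]

theorem diffGen_eq_phiHom_of_rightCusp (hC : C.IsAForm) (hL : L.IsRightPlat) {a : L.Generator}
    (hk : L.word.get a.1 = .rightCusp k) :
    C.diffGen a = Front.phiHom C.augmentation (L.ceGen a) := by
  obtain ⟨m, hm⟩ := C.exists_tangle a.1
  have hke := hL.even_of_rightCusp (Front.getElem?_of_get hk)
  have hm_settled : C.Settled m := hC.settled hm fun l => by rw [hk]; nofun
  calc C.diffGen a = C.chordSum m k (k + 1) := C.diffGen_eq hm (Or.inr hk)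
    _ = 1 + C.fullSum m k (k + 1) := by
      rw [fullSum, coeffAlg, (C.rightCusp m a.1 k hm hk).1, map_one, add_left_comm,
        CharTwo.add_self_eq_zero, add_zero]
    _ = 1 + Front.phiHom C.augmentation (L.diskSum a.1 k (k + 1)) := by
      rw [hC.fullSum_pair_eq hL hm_settled hke (C.fits hm hk), C.gap_eq hm]
    _ = Front.phiHom C.augmentation (L.ceGen a) := by
      rw [Front.ceGen_eq (Or.inr hk), if_pos ⟨k, hk⟩, map_add, map_one]

theorem diffGen_eq_phiHom (hC : C.IsAForm) (hL : L.IsRightPlat) (a : L.Generator) :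
    C.diffGen a = Front.phiHom C.augmentation (L.ceGen a) := by
  rcases a.2 with ⟨k, hk⟩ | ⟨k, hk⟩
  · exact hC.diffGen_eq_phiHom_of_crossing hL hk
  · exact hC.diffGen_eq_phiHom_of_rightCusp hL hk

theorem degree_eq_zero_of_isMarked (hC : C.IsAForm) {q : L.Generator} (hq : C.IsMarked q) :
    Front.degree μ q = 0 := by
  obtain ⟨⟨k, hk⟩, m, k', l, h_slide, h_sing⟩ := hq
  have val_eq := (C.handleslide_mark m k (k + 1) (hC.handleslide_eq h_sing hk h_slide)).2.2
  rw [C.degree_eq_val_gap h_sing hk, C.gap_succ_handleslide h_slide, val_eq, sub_self]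

theorem isAugmentation (hC : C.IsAForm) (hL : L.IsRightPlat) :
    Front.IsAugmentation μ C.augmentation := by
  refine ⟨map_leibnizExt_eq_zero _ fun q => ?_, fun q hq => ?_⟩
  · rw [← Front.algebraMapInv_phiHom, ← hC.diffGen_eq_phiHom hL, algebraMapInv_diffGen]
  · exact hC.degree_eq_zero_of_isMarked (by_contra fun h => by simp [augmentation_ι, h] at hq)

theorem diff_eq (hC : C.IsAForm) (hL : L.IsRightPlat) : C.diff = L.augDiff C.augmentation := by
  rw [diff, Front.augDiff_eq_leibnizExt, funext (hC.diffGen_eq_phiHom hL)]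

end IsAForm

end MCS

end Legendrian

theorem theorem7p2_general (L : Legendrian.Front) (hL : L.IsRightPlat) (μ : L.MaslovPotential)
    (C : Legendrian.MCS L μ) (hC : C.IsAForm) :
    Legendrian.Front.IsAugmentation μ C.augmentation ∧
      C.dga = Legendrian.Front.augDGA μ C.augmentation := by
  refine ⟨hC.isAugmentation hL, ?_⟩
  rw [Legendrian.MCS.dga, Legendrian.Front.augDGA, hC.diff_eq hL]

theorem theorem7p2 (L : Legendrian.Front) (hL : L.IsNearlyPlat) (μ : L.MaslovPotential)
    (C : Legendrian.MCS L μ) (hC : C.IsAForm) :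
    Legendrian.Front.IsAugmentation μ C.augmentation ∧
      C.dga = Legendrian.Front.augDGA μ C.augmentation :=
  theorem7p2_general L hL.isRightPlat μ C hC
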